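/- Let $E$ and $F$ be Polish spaces with their Borel $\sigma$-fields, let $(P_x)_{x\in F}$ be Markov kernels on $E$ such that $(x,y)\mapsto P_x(y,A)$ is measurable for every Borel set $A\subseteq E$, and let $X=(X_t)_{t\in\mathbb Z}$ be an $F$-valued process on a probability space $(\Omega,\mathcal A,\mathbb P)$. Products of kernels are $RS(y,A)=\int_E R(y,dy')S(y',A)$, a measure acts by $\mu P_x(A)=\int_E\mu(dy)P_x(y,A)$, and $P_xV(y)=\int_E V(y')P_x(y,dy')$. Assume: (A1) $X$ is (strictly) stationary. (A2) $V:E\to(0,\infty)$ is measurable and there are measurable $\lambda,b:F\to[0,\infty)$ with $\mathbb E[\log^+\lambda(X_0)]<\infty$ and $\mathbb E[\log^+ b(X_0)]<\infty$ (where $\log^+ u=\log\max(u,1)$) such that $P_xV\le\lambda(x)V+b(x)$ for all $x\in F$ and $$\limsup_{n\to\infty}\Big(\prod_{i=1}^n\lambda(X_{-i})\Big)^{1/n}<1\quad\text{a.s.}$$ (A3) There is a measurable $\eta:(0,\infty)\times F\to(0,1)$ such that for every $R>0$ there is a probability kernel $\nu_R$ from $F$ to $E$ with $P_x(y,A)\ge\eta(R,x)\,\nu_R(x,A)$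 for all $x\in F$, all $y\in E$ with $V(y)\le R$ and all Borel $A\subseteq E$. Put $\xi_t=(X_{t-j})_{j\ge0}\in F^{\mathbb N}$ and $d_{TV}(\mu,\mu')=\sup_{A}|\mu(A)-\mu'(A)|$, the supremum being over the Borel sets $A\subseteq E$. Then there is a probability kernel $p\mapsto\pi_p$ from $F^{\mathbb N}$ to $E$ such that: 1. Almost surely, for every $z\in E$, the measures $\delta_zP_{X_{-n}}\cdots P_{X_{-1}}$ converge in total variation to $\pi_{\xi_{-1}}$ as $n\to\infty$. Moreover there are random variables $C$ with values in $(0,\infty)$ and $\kappa$ with values in $(0,1)$, not depending on $z$, such that almost surely, for all $z\in E$ and all integers $n\ge0$, $$d_{TV}\big(\delta_zP_{X_{-n}}\cdots P_{X_{-1}},\,\pi_{\xi_{-1}}\big)\le C\,(1+V(z))\,\kappa^n.$$ 2. For every $t\in\mathbb Z$, $\pi_{\xi_{t-1}}P_{X_t}=\pi_{\xi_t}$ a.s., and the random measures $\pi_{\xi_t}$, $t\in\mathbb Z$, are identically distributed. 3. If $(\nu_t)_{t\in\mathbb Z}$ are identically distributed random probability measures on $E$, defined on $\Omega$, with $\nu_{t-1}P_{X_t}=\nu_t$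 a.s. for every $t\in\mathbb Z$, then $\nu_t=\pi_{\xi_t}$ a.s. for every $t\in\mathbb Z$. 4. $\int_E V\,d\pi_{\xi_{-1}}<\infty$ a.s. -/

import Mathlib

open MeasureTheory ProbabilityTheory Filter Topology
open scoped ENNReal NNReal

/-- Strict stationarity of a process indexed by `ℤ`: the law of the whole path on `ℤ → F` is
invariant under every time shift. -/
def IsStationaryProcess {Ω F : Type*} [MeasurableSpace Ω] [MeasurableSpace F]
    (Pr : Measure Ω) (X : ℤ → Ω → F) : Prop :=
  ∀ h : ℤ, IdentDistrib (fun ω t => X (t + h) ω) (fun ω t => X t ω) Pr Pr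

/-- The class `𝓛` of measurable functions `γ : F → [0, ∞)` with `𝔼[log⁺ γ(X₀)] < ∞`. -/
def HasLogMoment {Ω F : Type*} [MeasurableSpace Ω] [MeasurableSpace F]
    (Pr : Measure Ω) (X : ℤ → Ω → F) (γ : F → ℝ≥0) : Prop :=
  Measurable γ ∧ Integrable (fun ω => Real.posLog (γ (X 0 ω) : ℝ)) Pr

/-- Drift condition with random coefficients: `P_x V ≤ lam(x) V + b(x)` for all `x`, with
`lam, b ∈ 𝓛`, and `limsup_n (∏_{i=1}^n lam(X_{-i}))^{1/n} < 1` almost surely.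
The kernel `P : Kernel (F × E) E` encodes the family `P_x(y, ·) = P (x, y)`. -/
structure DriftCondition {Ω E F : Type*} [MeasurableSpace Ω] [MeasurableSpace E]
    [MeasurableSpace F] (Pr : Measure Ω) (X : ℤ → Ω → F) (P : Kernel (F × E) E)
    (V : E → ℝ) (lam b : F → ℝ≥0) : Prop where
  measurable_V : Measurable V
  V_pos : ∀ y, 0 < V y
  lam_mem : HasLogMoment Pr X lam
  b_mem : HasLogMoment Pr X b
  drift : ∀ x y, ∫⁻ y', ENNReal.ofReal (V y') ∂(P (x, y)) ≤
    (lam x : ℝ≥0∞) * ENNReal.ofReal (V y) + (b x : ℝ≥0∞)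
  limsup_lt_one : ∀ᵐ ω ∂Pr,
    limsup (fun n : ℕ =>
      (∏ i ∈ Finset.Icc 1 n, (lam (X (-(i : ℤ)) ω) : ℝ≥0∞)) ^ ((1 : ℝ) / (n : ℝ))) atTop < 1

/-- Minorization condition: every level set `{V ≤ R}`, `R > 0`, is a small set for all the
kernels `P_x`, with minorizing constant `η(R, x) ∈ (0, 1)` and a minorizing probability kernel
`ν_R` from `F` to `E`. Only the values `η R x` with `R > 0` matter. -/
structure SmallSetCondition {E F : Type*} [MeasurableSpace E] [MeasurableSpace F]
    (P : Kernel (F × E) E) (V : E → ℝ) (η : ℝ → F → ℝ) : Prop where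
  measurable_eta : Measurable (fun p : Set.Ioi (0 : ℝ) × F => η p.1 p.2)
  eta_pos : ∀ R, 0 < R → ∀ x, 0 < η R x
  eta_lt_one : ∀ R, 0 < R → ∀ x, η R x < 1
  minorization : ∀ R : ℝ, 0 < R → ∃ ν : Kernel F E, IsMarkovKernel ν ∧
    ∀ x y, V y ≤ R → ∀ A, MeasurableSet A → ENNReal.ofReal (η R x) * ν x A ≤ P (x, y) A

/-- Total variation distance `sup_A |μ(A) - ν(A)|` over measurable sets (used for probability
measures, for which the supremum is over a bounded non-empty set). -/
noncomputable def tvDist {E : Type*} [MeasurableSpace E] (μ ν : Measure E) : ℝ :=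
  ⨆ A : {A : Set E // MeasurableSet A}, |μ.real A - ν.real A|

/-- The past of the process at time `t`: `ξ_t = (X_t, X_{t-1}, X_{t-2}, …)`. -/
def pastProcess {Ω F : Type*} (X : ℤ → Ω → F) (t : ℤ) (ω : Ω) : ℕ → F :=
  fun j => X (t - (j : ℤ)) ω

/-- The measure `μ P_x`, i.e. `A ↦ ∫ μ(dy) P_x(y, A)`. -/
noncomputable def stepMeasure {E F : Type*} [MeasurableSpace E] [MeasurableSpace F]
    (P : Kernel (F × E) E) (μ : Measure E) (x : F) : Measure E :=
  μ.bind (P.sectR x)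

/-- `backwardIter P x n μ = μ P_{x_{n-1}} ⋯ P_{x_1} P_{x_0}`: the kernel with the largest index
is applied first. For `n = 0` this is `μ`. With `x = ξ_{-1}` and `μ = δ_z` it is
`δ_z P_{X_{-n}} ⋯ P_{X_{-1}}`. -/
noncomputable def backwardIter {E F : Type*} [MeasurableSpace E] [MeasurableSpace F]
    (P : Kernel (F × E) E) (x : ℕ → F) : ℕ → Measure E → Measure E
  | 0, μ => μ
  | n + 1, μ => backwardIter P x n (stepMeasure P μ (x n))

/-! Measure the oscillation of a bounded function by the weight (1 + (V y + V y')/(k+1))^(1/(l+1)).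
Applying P_x multiplies it by at most exp(`envRate`/(l+1))
(`DriftMinorization.abs_integral_sub_le`): where V y + V y' > (k+1)^2 the drift gives the bound,
elsewhere Hölder's inequality is applied to the mass left after removing the common minorizing part.
As l → ∞ the minorization branch drops out of the rate, and as k → ∞ the effect of b disappears,
leaving log λ(x).

The process need not be ergodic, so k and l depend on the path. On the invariant set of paths where
no rate has negative averages, the maximal ergodic theorem gives every rate a nonnegative integral;
letting l, then k, tend to infinity gives ∫ log λ ≥ 0 there. Exponential decay of the products of λ
contradicts this unless the set is null (`ae_exists_mem_birkhoffLimsupLE_logRate`).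

The log moments make λ(X_{-n}) and b(X_{-n}) subexponential, so almost every past is contracting
(`exists_isContracting`). Backward iterates then form a Cauchy sequence uniformly over measurable
sets, with a limit independent of z. Invariance and integrability of V follow from a Fatou lemma for
setwise convergence. For uniqueness, ν_t is the n-step image of ν_{t-n}, and identical laws keep
enough of ν_{t-n} in a level set of V along a random subsequence. -/

/-! ### Maximal ergodic theorem. -/

/-- The running maximum `max(0, S₁ f, …, S_n f)` of the Birkhoff sums of `f`. -/
noncomputable def birkhoffMax {α : Type*} (T : α → α) (f : α → ℝ) : ℕ → α → ℝ
  | 0, _ => 0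
  | n + 1, x => max 0 (f x + birkhoffMax T f n (T x))

section BirkhoffMax

variable {α : Type*} {T : α → α} {f : α → ℝ}

lemma birkhoffMax_nonneg (n : ℕ) (x : α) : 0 ≤ birkhoffMax T f n x := by
  cases n with
  | zero => exact le_rfl
  | succ n => exact le_max_left _ _

lemma birkhoffMax_le_succ (n : ℕ) (x : α) : birkhoffMax T f n x ≤ birkhoffMax T f (n + 1) x := by
  induction n generalizing x with
  | zero => exact birkhoffMax_nonneg _ _
  | succ n ih => exact max_le_max le_rfl (by gcongr; exact ih (T x))

lemma birkhoffMax_mono (x : α) : Monotone fun n => birkhoffMax T f n x :=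
  monotone_nat_of_le_succ fun n => birkhoffMax_le_succ n x

lemma birkhoffSum_le_birkhoffMax (n : ℕ) (x : α) : birkhoffSum T f n x ≤ birkhoffMax T f n x := by
  induction n generalizing x with
  | zero => simp [birkhoffMax]
  | succ n ih =>
    rw [birkhoffSum_succ']
    exact le_max_of_le_right (by gcongr; exact ih (T x))

variable [MeasurableSpace α] {μ : Measure α}

lemma integrable_birkhoffMax (hT : MeasurePreserving T μ μ) (hf : Integrable f μ) (n : ℕ) :
    Integrable (birkhoffMax T f n) μ := by
  induction n with
  | zero => exact integrable_zero _ _ _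
  | succ n ih =>
    exact (integrable_zero α ℝ μ).sup (hf.add (hT.integrable_comp_of_integrable ih))

lemma measurable_birkhoffMax (hT : Measurable T) (hf : Measurable f) (n : ℕ) :
    Measurable (birkhoffMax T f n) := by
  induction n with
  | zero => exact measurable_const
  | succ n ih => exact measurable_const.max (hf.add (ih.comp hT))

/-- Garsia's argument: where the maximum is positive, f is its difference with the previous maximum
composed with T; elsewhere that difference is at most 0. Its integral is nonnegative because T
preserves μ and the maxima increase. -/
lemma setIntegral_birkhoffMax_pos_nonneg (hT : MeasurePreserving T μ μ) (hf : Integrable f μ)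
    (hfm : Measurable f) (n : ℕ) : 0 ≤ ∫ x in {x | 0 < birkhoffMax T f (n + 1) x}, f x ∂μ := by
  have hA : MeasurableSet {x | 0 < birkhoffMax T f (n + 1) x} :=
    measurableSet_lt measurable_const (measurable_birkhoffMax hT.measurable hfm _)
  have hi1 := integrable_birkhoffMax hT hf (n + 1)
  have hi0 := integrable_birkhoffMax hT hf n
  have hiT : Integrable (fun x => birkhoffMax T f n (T x)) μ := hT.integrable_comp_of_integrable hi0
  have hTint : ∫ x, birkhoffMax T f n (T x) ∂μ = ∫ x, birkhoffMax T f n x ∂μ := by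
    have h := integral_map (μ := μ) hT.measurable.aemeasurable
      (f := birkhoffMax T f n) (by rw [hT.map_eq]; exact hi0.1)
    rw [hT.map_eq] at h
    exact h.symm
  rw [← integral_indicator hA]
  calc (0 : ℝ) ≤ ∫ x, birkhoffMax T f (n + 1) x ∂μ - ∫ x, birkhoffMax T f n x ∂μ :=
        sub_nonneg.2 (integral_mono hi0 hi1 fun x => birkhoffMax_le_succ n x)
    _ = ∫ x, (birkhoffMax T f (n + 1) x - birkhoffMax T f n (T x)) ∂μ := by
        rw [integral_sub hi1 hiT, hTint]
    _ ≤ _ := by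
        refine integral_mono (hi1.sub hiT) (hf.indicator hA) fun x => ?_
        by_cases hx : 0 < birkhoffMax T f (n + 1) x
        · have h1 : birkhoffMax T f (n + 1) x = f x + birkhoffMax T f n (T x) := by
            have h2 : birkhoffMax T f (n + 1) x = max 0 (f x + birkhoffMax T f n (T x)) := rfl
            rw [h2] at hx ⊢
            exact max_eq_right (by by_contra! hlt; simp [max_eq_left hlt.le] at hx)
          rw [Set.indicator_of_mem (by exact hx), h1]
          linarith
        · rw [Set.indicator_of_notMem (by exact hx)]
          have := birkhoffMax_nonneg (T := T) (f := f) n (T x)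
          linarith

/-- Maximal ergodic theorem on an invariant set. -/
theorem setIntegral_nonneg_of_birkhoffSum_pos (hT : MeasurePreserving T μ μ) {G : Set α}
    (hG : MeasurableSet G) (hGT : ∀ x, T x ∈ G ↔ x ∈ G) (hf : Integrable (G.indicator f) μ)
    (hfm : Measurable f) (hpos : ∀ x ∈ G, ∃ n, 0 < birkhoffSum T f n x) :
    0 ≤ ∫ x in G, f x ∂μ := by
  -- Only the indicator is integrable. Invariance of G makes its sums agree with those of f on G,
  -- and its maxima vanish outside G.
  set F := G.indicator f with hF
  have hFm : Measurable F := hfm.indicator hG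
  have hout : ∀ n, ∀ x ∉ G, birkhoffMax T F n x = 0 := by
    intro n
    induction n with
    | zero => intro x _; rfl
    | succ n ih =>
      intro x hx
      rw [birkhoffMax, ih (T x) (by rwa [hGT]), hF, Set.indicator_of_notMem hx]
      simp
  have hin : ∀ n, ∀ x ∈ G, birkhoffSum T F n x = birkhoffSum T f n x := by
    intro n
    induction n with
    | zero => intro x _; simp
    | succ n ih =>
      intro x hx
      rw [birkhoffSum_succ', birkhoffSum_succ', ih (T x) (by rwa [hGT]), hF,
        Set.indicator_of_mem hx]
  set A : ℕ → Set α := fun n => {x | 0 < birkhoffMax T F (n + 1) x} with hA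
  have hAm : ∀ n, MeasurableSet (A n) := fun n =>
    measurableSet_lt measurable_const (measurable_birkhoffMax hT.measurable hFm _)
  have hAmono : Monotone A := fun m n hmn x hx =>
    lt_of_lt_of_le hx (birkhoffMax_mono x (by lia))
  have hAU : ⋃ n, A n = G := by
    ext x
    simp only [Set.mem_iUnion]
    constructor
    · rintro ⟨n, hn⟩
      by_contra hx
      simp only [hA, Set.mem_ofPred_eq, hout _ x hx, lt_irrefl] at hn
    · intro hx
      obtain ⟨n, hn⟩ := hpos x hx
      refine ⟨n, hn.trans_le ?_⟩
      rw [← hin n x hx]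
      exact (birkhoffSum_le_birkhoffMax n x).trans (birkhoffMax_le_succ n x)
  have hlim := tendsto_setIntegral_of_monotone (μ := μ) hAm hAmono (f := F) hf.integrableOn
  rw [hAU] at hlim
  have h0 := ge_of_tendsto' hlim fun n => setIntegral_birkhoffMax_pos_nonneg hT hf hFm n
  rwa [setIntegral_congr_fun hG (fun x hx => Set.indicator_of_mem hx f)] at h0

end BirkhoffMax

/-! ### Upper limits of Birkhoff averages. -/

lemma eventually_atTop_succ_iff {p : ℕ → Prop} :
    (∀ᶠ n in atTop, p (n + 1)) ↔ ∀ᶠ n in atTop, p n := by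
  conv_rhs => rw [← map_add_atTop_eq_nat 1, eventually_map]

/-- The set of points at which the upper limit of the Birkhoff averages is at most `c`. -/
def birkhoffLimsupLE {α : Type*} (T : α → α) (f : α → ℝ) (c : ℝ) : Set α :=
  {x | ∀ j : ℕ, ∀ᶠ n : ℕ in atTop, birkhoffSum T f n x ≤ (c + 1 / ((j : ℝ) + 1)) * n}

section BirkhoffLimsup

variable {α : Type*} {T : α → α} {f : α → ℝ} {c : ℝ}

/-- The countable family of slopes in the definition gives measurability; arbitrary slopes d > c are
easier to use. -/
lemma mem_birkhoffLimsupLE_iff {x : α} : x ∈ birkhoffLimsupLE T f c ↔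
    ∀ d, c < d → ∀ᶠ n : ℕ in atTop, birkhoffSum T f n x ≤ d * n := by
  constructor
  · intro hx d hd
    obtain ⟨j, hj⟩ := exists_nat_one_div_lt (sub_pos.2 hd)
    filter_upwards [hx j] with n hn
    exact hn.trans (mul_le_mul_of_nonneg_right (by linarith) n.cast_nonneg)
  · exact fun h j => h _ (lt_add_of_pos_right _ (by positivity))

/-- The sums at x and T x differ by f x and a shift of the index, which the gap between d and (c +
d)/2 absorbs. The invariance is exact, as the maximal theorem requires. -/
lemma apply_mem_birkhoffLimsupLE_iff (x : α) :
    T x ∈ birkhoffLimsupLE T f c ↔ x ∈ birkhoffLimsupLE T f c := by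
  have hsucc : ∀ n, birkhoffSum T f (n + 1) x = f x + birkhoffSum T f n (T x) :=
    fun n => birkhoffSum_succ' T f n x
  simp only [mem_birkhoffLimsupLE_iff]
  have hlarge : ∀ K e : ℝ, 0 < e → ∀ᶠ n : ℕ in atTop, K ≤ e * n := fun K e he =>
    (tendsto_natCast_atTop_atTop.const_mul_atTop he).eventually_ge_atTop K
  constructor
  · intro h d hd
    rw [← eventually_atTop_succ_iff (p := fun n : ℕ => birkhoffSum T f n x ≤ d * n)]
    filter_upwards [h ((c + d) / 2) (by linarith),
      hlarge (f x - d) ((d - c) / 2) (by linarith)] with n h1 h2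
    rw [hsucc]; push_cast; linarith
  · intro h d hd
    have h' := h ((c + d) / 2) (by linarith)
    rw [← eventually_atTop_succ_iff (p := fun n : ℕ => birkhoffSum T f n x ≤ (c + d) / 2 * n)]
      at h'
    filter_upwards [h', hlarge ((c + d) / 2 - f x) ((d - c) / 2) (by linarith)] with n h1 h2
    rw [hsucc] at h1; push_cast at h1; linarith

variable [MeasurableSpace α]

lemma Measurable.birkhoffSum (hT : Measurable T) (hf : Measurable f) (n : ℕ) :
    Measurable (birkhoffSum T f n) :=
  Finset.measurable_fun_sum _ fun i _ => hf.comp (hT.iterate i)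

lemma measurableSet_birkhoffLimsupLE (hT : Measurable T) (hf : Measurable f) :
    MeasurableSet (birkhoffLimsupLE T f c) := by
  simp only [birkhoffLimsupLE, Set.ofPred_forall]
  refine MeasurableSet.iInter fun j => ?_
  simp only [eventually_atTop, Set.ofPred_exists, Set.ofPred_forall]
  exact MeasurableSet.iUnion fun N => MeasurableSet.iInter fun n => MeasurableSet.iInter fun _ =>
    measurableSet_le (Measurable.birkhoffSum hT hf n) measurable_const

/-- If the upper limit of the Birkhoff averages is nonnegative on an invariant set, then so is the
integral over this set. -/
lemma setIntegral_nonneg_of_notMem_birkhoffLimsupLE {μ : Measure α} [IsFiniteMeasure μ]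
    (hT : MeasurePreserving T μ μ) {G : Set α}
    (hG : MeasurableSet G) (hGT : ∀ x, T x ∈ G ↔ x ∈ G) (hf : Integrable f μ)
    (hfm : Measurable f)
    (hpos : ∀ x ∈ G, ∀ i : ℕ, x ∉ birkhoffLimsupLE T f (-(1 / ((i : ℝ) + 1)))) :
    0 ≤ ∫ x in G, f x ∂μ := by
  -- Adding e turns a nonnegative upper limit into strictly positive sums, as the maximal theorem
  -- requires; e is then made small.
  have key : ∀ e : ℝ, 0 < e → 0 ≤ ∫ x in G, f x ∂μ + e * μ.real G := by
    intro e he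
    have h := setIntegral_nonneg_of_birkhoffSum_pos (f := fun x => f x + e) hT hG hGT
      ((hf.add (integrable_const e)).indicator hG) (hfm.add_const e) ?_
    · rwa [integral_add hf.integrableOn (integrable_const e).integrableOn, setIntegral_const,
        smul_eq_mul, mul_comm] at h
    · intro x hx
      obtain ⟨i, hi⟩ := exists_nat_one_div_lt he
      have h1 := hpos x hx i
      rw [mem_birkhoffLimsupLE_iff] at h1
      push Not at h1
      obtain ⟨d, hd, h2⟩ := h1
      obtain ⟨n, hn, h3⟩ := h2.forall_exists_of_atTop 1
      refine ⟨n, ?_⟩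
      have h4 : birkhoffSum T (fun x => f x + e) n x = birkhoffSum T f n x + e * n := by
        simp [birkhoffSum, Finset.sum_add_distrib, mul_comm]
      have hn' : (0 : ℝ) < n := by exact_mod_cast hn
      rw [h4]
      nlinarith
  by_contra! hlt
  -- This e costs at most half of the supposedly negative integral; the + 1 covers a null G.
  have h1 := key (-(∫ x in G, f x ∂μ) / (2 * (μ.real G + 1)))
    (div_pos (by linarith) (by have := measureReal_nonneg (μ := μ) (s := G); linarith))
  have h2 := measureReal_nonneg (μ := μ) (s := G)
  have h3 : -(∫ x in G, f x ∂μ) / (2 * (μ.real G + 1)) * μ.real G ≤ -(∫ x in G, f x ∂μ) / 2 := by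
    rw [div_mul_eq_mul_div, div_le_div_iff₀ (by linarith) (by norm_num)]
    nlinarith
  linarith

end BirkhoffLimsup

/-! ### Logarithmic rates and their limits. -/

/-- Logarithmic contraction rate of a kernel with drift coefficients `a`, `b` and with a
minorization of logarithmic defect `e`, for the weight `1 + (V y + V y') / (k + 1)` to the power
`1 / (l + 1)`; the rate is multiplied by `l + 1`. -/
noncomputable def logRate (a b e : ℝ) (k l : ℕ) : ℝ :=
  Real.log (1 + 2 * b / ((k : ℝ) + 1)) +
    max (Real.log (a + 1 / ((k : ℝ) + 2))) (Real.posLog a + l * e)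

/-- The limit of `logRate a b e k l` as `l → ∞`, when `e < 0`. -/
noncomputable def logRateLim (a b : ℝ) (k : ℕ) : ℝ :=
  Real.log (1 + 2 * b / ((k : ℝ) + 1)) + Real.log (a + 1 / ((k : ℝ) + 2))

section LogRate

variable {a b e : ℝ}

lemma log_le_posLog_add_log {x c : ℝ} (ha : 0 ≤ a) (hx : 0 < x) (hc : 0 < c)
    (h : x ≤ c * max 1 a) : Real.log x ≤ Real.log c + Real.posLog a := by
  rw [Real.posLog_eq_log_max_one ha, ← Real.log_mul hc.ne' (by positivity)]
  exact Real.log_le_log hx h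

lemma log_one_add_div_nonneg (hb : 0 ≤ b) (k : ℕ) : 0 ≤ Real.log (1 + 2 * b / ((k : ℝ) + 1)) :=
  Real.log_nonneg (by have : 0 ≤ 2 * b / ((k : ℝ) + 1) := by positivity
                      linarith)

lemma log_one_add_div_le (hb : 0 ≤ b) (k : ℕ) :
    Real.log (1 + 2 * b / ((k : ℝ) + 1)) ≤ Real.log 3 + Real.posLog b := by
  refine log_le_posLog_add_log hb (by positivity) (by norm_num) ?_
  have h1 : 2 * b / ((k : ℝ) + 1) ≤ 2 * b := div_le_self (by positivity) (by simp)
  linarith [le_max_left 1 b, le_max_right 1 b]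

lemma one_div_add_two_le (k : ℕ) : 1 / ((k : ℝ) + 2) ≤ 1 := by
  rw [div_le_one (by positivity)]; linarith [k.cast_nonneg (α := ℝ)]

lemma log_add_div_le (ha : 0 ≤ a) (k : ℕ) :
    Real.log (a + 1 / ((k : ℝ) + 2)) ≤ Real.log 2 + Real.posLog a := by
  refine log_le_posLog_add_log ha (by positivity) (by norm_num) ?_
  linarith [le_max_left 1 a, le_max_right 1 a, one_div_add_two_le k]

lemma neg_log_le_log_add_div (ha : 0 ≤ a) (k : ℕ) :
    -Real.log ((k : ℝ) + 2) ≤ Real.log (a + 1 / ((k : ℝ) + 2)) := by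
  rw [← Real.log_inv]
  exact Real.log_le_log (by positivity) (by rw [one_div]; linarith)

/-- The majorant does not depend on l or e, so it serves for dominated convergence in l. The offset
1/(k+2) gives the lower bound even when a = 0. -/
lemma abs_logRate_le (ha : 0 ≤ a) (hb : 0 ≤ b) (he : e ≤ 0) (k l : ℕ) :
    |logRate a b e k l| ≤
      Real.log 3 + Real.log 2 + Real.log ((k : ℝ) + 2) + Real.posLog a + Real.posLog b := by
  have h1 := log_one_add_div_nonneg hb k
  have h2 := log_one_add_div_le hb k
  have h3 := log_add_div_le ha k
  have h4 := neg_log_le_log_add_div ha k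
  have h5 : (l : ℝ) * e ≤ 0 := mul_nonpos_of_nonneg_of_nonpos l.cast_nonneg he
  have h6 : 0 ≤ Real.log 2 := Real.log_nonneg (by norm_num)
  have h7 : 0 ≤ Real.log 3 := Real.log_nonneg (by norm_num)
  have h8 : 0 ≤ Real.log ((k : ℝ) + 2) :=
    Real.log_nonneg (by linarith [k.cast_nonneg (α := ℝ)])
  have h9 : 0 ≤ Real.posLog a := Real.posLog_nonneg
  have h10 : 0 ≤ Real.posLog b := Real.posLog_nonneg
  have h11 := le_max_left (Real.log (a + 1 / ((k : ℝ) + 2))) (Real.posLog a + l * e)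
  have h12 : max (Real.log (a + 1 / ((k : ℝ) + 2))) (Real.posLog a + l * e) ≤
      Real.log 2 + Real.posLog a := max_le h3 (by linarith)
  rw [logRate, abs_le]
  constructor <;> linarith

lemma abs_logRateLim_le (ha : 0 ≤ a) (hb : 0 ≤ b) (k : ℕ) :
    |logRateLim a b k| ≤
      Real.log 3 + Real.log 2 + Real.log ((k : ℝ) + 2) + Real.posLog a + Real.posLog b := by
  have h1 := log_one_add_div_nonneg hb k
  have h2 := log_one_add_div_le hb k
  have h3 := log_add_div_le ha k
  have h4 := neg_log_le_log_add_div ha k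
  have h6 : 0 ≤ Real.log 2 := Real.log_nonneg (by norm_num)
  have h7 : 0 ≤ Real.log 3 := Real.log_nonneg (by norm_num)
  have h8 : 0 ≤ Real.log ((k : ℝ) + 2) :=
    Real.log_nonneg (by linarith [k.cast_nonneg (α := ℝ)])
  have h9 : 0 ≤ Real.posLog a := Real.posLog_nonneg
  have h10 : 0 ≤ Real.posLog b := Real.posLog_nonneg
  rw [logRateLim, abs_le]
  constructor <;> linarith

lemma tendsto_logRate (he : e < 0) (k : ℕ) :
    Tendsto (fun l => logRate a b e k l) atTop (𝓝 (logRateLim a b k)) := by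
  have h : Tendsto (fun l : ℕ => Real.posLog a + (l : ℝ) * e) atTop atBot :=
    tendsto_atBot_add_const_left _ _ (tendsto_natCast_atTop_atTop.atTop_mul_const_of_neg he)
  refine tendsto_const_nhds.congr' ?_
  filter_upwards [h.eventually_le_atBot (Real.log (a + 1 / ((k : ℝ) + 2)))] with l hl
  rw [logRate, logRateLim, max_eq_left hl]

lemma tendsto_add_one_div_add_two (a : ℝ) :
    Tendsto (fun k : ℕ => a + 1 / ((k : ℝ) + 2)) atTop (𝓝 a) := by
  have h := (tendsto_const_nhds (x := a)).add
    ((tendsto_one_div_add_atTop_nhds_zero_nat (𝕜 := ℝ)).comp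
    (tendsto_add_atTop_nat 1))
  rw [add_zero] at h
  refine h.congr fun k => ?_
  simp only [Function.comp_apply]
  push_cast; ring_nf

lemma tendsto_log_one_add_div (b : ℝ) :
    Tendsto (fun k : ℕ => Real.log (1 + 2 * b / ((k : ℝ) + 1))) atTop (𝓝 0) := by
  have h : Tendsto (fun k : ℕ => 1 + 2 * b * (1 / ((k : ℝ) + 1))) atTop (𝓝 1) := by
    simpa using ((tendsto_one_div_add_atTop_nhds_zero_nat (𝕜 := ℝ)).const_mul (2 * b)).const_add 1
  have h2 := h.log one_ne_zero
  rw [Real.log_one] at h2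
  simpa [div_eq_mul_inv] using h2

lemma tendsto_logRateLim (ha : 0 < a) :
    Tendsto (fun k => logRateLim a b k) atTop (𝓝 (Real.log a)) := by
  have h := (tendsto_log_one_add_div b).add ((tendsto_add_one_div_add_two a).log ha.ne')
  rwa [zero_add] at h

/-- The case a = 0 is separate because `Real.log 0 = 0` is not the limit. -/
lemma tendsto_logRateLim_zero : Tendsto (fun k => logRateLim 0 b k) atTop atBot := by
  refine (tendsto_log_one_add_div b).add_atBot ?_
  refine Real.tendsto_log_nhdsGT_zero.comp (tendsto_nhdsWithin_iff.2
    ⟨tendsto_add_one_div_add_two 0, Eventually.of_forall fun k => ?_⟩)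
  simp only [zero_add, Set.mem_Ioi]; positivity

/-- The value at k = 0 is an upper envelope, so its difference with the later values is nonnegative
and Fatou applies. -/
lemma logRateLim_le_zero (ha : 0 ≤ a) (hb : 0 ≤ b) (k : ℕ) :
    logRateLim a b k ≤ logRateLim a b 0 := by
  unfold logRateLim
  have hk := k.cast_nonneg (α := ℝ)
  gcongr <;> simp

end LogRate

/-! ### Almost every orbit decays at one of the rates. -/

lemma birkhoffSum_log_eq_log_prod {α : Type*} {T : α → α} {a : α → ℝ} (x : α) (n : ℕ)
    (h : ∀ i, 0 < a (T^[i] x)) :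
    birkhoffSum T (fun x => Real.log (a x)) n x =
      Real.log (∏ i ∈ Finset.range n, a (T^[i] x)) := by
  rw [Real.log_prod fun i _ => (h i).ne']
  rfl

section Ergodic

variable {α : Type*} [MeasurableSpace α] {μ : Measure α} [IsFiniteMeasure μ] {T : α → α}
  {a b : α → ℝ} {e : ℕ → α → ℝ}

lemma setIntegral_logRateLim_nonneg
    (ha : Measurable a) (hb : Measurable b) (he : ∀ k, Measurable (e k))
    (ha0 : ∀ x, 0 ≤ a x) (hb0 : ∀ x, 0 ≤ b x) (he0 : ∀ k x, e k x < 0)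
    (hai : Integrable (fun x => Real.posLog (a x)) μ)
    (hbi : Integrable (fun x => Real.posLog (b x)) μ)
    (hT : MeasurePreserving T μ μ) {G : Set α} (hG : MeasurableSet G)
    (hGT : ∀ x, T x ∈ G ↔ x ∈ G)
    (hpos : ∀ x ∈ G, ∀ k l i : ℕ, x ∉ birkhoffLimsupLE T
      (fun x => logRate (a x) (b x) (e k x) k l) (-(1 / ((i : ℝ) + 1)))) (k : ℕ) :
    0 ≤ ∫ x in G, logRateLim (a x) (b x) k ∂μ := by
  have hbound : Integrable (fun x => Real.log 3 + Real.log 2 + Real.log ((k : ℝ) + 2) +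
      Real.posLog (a x) + Real.posLog (b x)) μ := ((integrable_const _).add hai).add hbi
  have hm : ∀ l, Measurable (fun x => logRate (a x) (b x) (e k x) k l) := fun l => by
    unfold logRate Real.posLog
    have := he k
    fun_prop
  have hlim := tendsto_integral_of_dominated_convergence (μ := μ.restrict G) _
    (fun l => (hm l).aestronglyMeasurable) hbound.integrableOn
    (fun l => ae_of_all _ fun x => abs_logRate_le (ha0 x) (hb0 x) (he0 k x).le k l)
    (ae_of_all _ fun x => tendsto_logRate (a := a x) (b := b x) (he0 k x) k)
  refine ge_of_tendsto' hlim fun l => ?_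
  refine setIntegral_nonneg_of_notMem_birkhoffLimsupLE hT hG hGT ?_ (hm l)
    fun x hx i => hpos x hx k l i
  exact hbound.mono' (hm l).aestronglyMeasurable
    (ae_of_all _ fun x => abs_logRate_le (ha0 x) (hb0 x) (he0 k x).le k l)

/-- Only the positive part of log a is known to be integrable. Fatou's lemma, applied to the drop
from k = 0 to k, bounds the negative part and also excludes a = 0, where the drop is infinite. -/
lemma setIntegral_log_nonneg
    (ha : Measurable a) (hb : Measurable b)
    (ha0 : ∀ x, 0 ≤ a x) (hb0 : ∀ x, 0 ≤ b x)
    (hai : Integrable (fun x => Real.posLog (a x)) μ)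
    (hbi : Integrable (fun x => Real.posLog (b x)) μ) {G : Set α}
    (hpos : ∀ k, 0 ≤ ∫ x in G, logRateLim (a x) (b x) k ∂μ) :
    (∀ᵐ x ∂μ.restrict G, 0 < a x) ∧ IntegrableOn (fun x => Real.log (a x)) G μ ∧
      0 ≤ ∫ x in G, Real.log (a x) ∂μ := by
  have hm : ∀ k, Measurable (fun x => logRateLim (a x) (b x) k) := fun k => by
    unfold logRateLim; fun_prop
  have hint : ∀ k, Integrable (fun x => logRateLim (a x) (b x) k) (μ.restrict G) := fun k => by
    refine Integrable.mono' (g := fun x => Real.log 3 + Real.log 2 + Real.log ((k : ℝ) + 2) +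
      Real.posLog (a x) + Real.posLog (b x)) ?_ (hm k).aestronglyMeasurable
      (ae_of_all _ fun x => abs_logRateLim_le (ha0 x) (hb0 x) k)
    exact (((integrable_const _).add hai).add hbi).integrableOn
  set φ : ℕ → α → ℝ≥0∞ := fun k x =>
    ENNReal.ofReal (logRateLim (a x) (b x) 0 - logRateLim (a x) (b x) k) with hφ
  have hφm : ∀ k, Measurable (φ k) := fun k => ((hm 0).sub (hm k)).ennreal_ofReal
  have hφint : ∀ k, ∫⁻ x in G, φ k x ∂μ ≤
      ENNReal.ofReal (∫ x in G, logRateLim (a x) (b x) 0 ∂μ) := fun k => by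
    have hsub : Integrable (fun x => logRateLim (a x) (b x) 0 - logRateLim (a x) (b x) k)
      (μ.restrict G) := (hint 0).sub (hint k)
    rw [hφ, ← ofReal_integral_eq_lintegral_ofReal hsub
      (ae_of_all _ fun x => sub_nonneg.2 (logRateLim_le_zero (ha0 x) (hb0 x) k)),
      integral_sub (hint 0) (hint k)]
    exact ENNReal.ofReal_le_ofReal (by linarith [hpos k])
  have hFatou : ∫⁻ x in G, liminf (fun k => φ k x) atTop ∂μ ≤
      ENNReal.ofReal (∫ x in G, logRateLim (a x) (b x) 0 ∂μ) := by
    refine (lintegral_liminf_le hφm).trans ?_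
    exact (liminf_le_liminf (Eventually.of_forall hφint)).trans (by simp)
  have hfin := ae_lt_top (Measurable.liminf hφm) (hFatou.trans_lt ENNReal.ofReal_lt_top).ne
  have hapos : ∀ᵐ x ∂μ.restrict G, 0 < a x := by
    filter_upwards [hfin] with x hx
    by_contra hlt
    have h0 : a x = 0 := le_antisymm (not_lt.1 hlt) (ha0 x)
    have : Tendsto (fun k => φ k x) atTop (𝓝 ∞) := by
      simp only [hφ, h0]
      refine ENNReal.tendsto_ofReal_nhds_top.2 ?_
      simp only [sub_eq_add_neg]
      exact tendsto_atTop_add_const_left _ _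
        (tendsto_neg_atBot_atTop.comp tendsto_logRateLim_zero)
    exact hx.ne this.liminf_eq
  have hlimeq : ∀ᵐ x ∂μ.restrict G, liminf (fun k => φ k x) atTop =
      ENNReal.ofReal (logRateLim (a x) (b x) 0 - Real.log (a x)) := by
    filter_upwards [hapos] with x hx
    exact (ENNReal.tendsto_ofReal ((tendsto_logRateLim hx).const_sub _)).liminf_eq
  rw [lintegral_congr_ae hlimeq] at hFatou
  have hnn : ∀ᵐ x ∂μ.restrict G, 0 ≤ logRateLim (a x) (b x) 0 - Real.log (a x) := by
    filter_upwards [hapos] with x hx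
    exact ge_of_tendsto' ((tendsto_logRateLim (b := b x) hx).const_sub _)
      fun k => sub_nonneg.2 (logRateLim_le_zero (ha0 x) (hb0 x) k)
  have hdm : Measurable (fun x => logRateLim (a x) (b x) 0 - Real.log (a x)) := by
    have := hm 0; fun_prop
  have hdint : Integrable (fun x => logRateLim (a x) (b x) 0 - Real.log (a x)) (μ.restrict G) :=
    (lintegral_ofReal_ne_top_iff_integrable hdm.aestronglyMeasurable hnn).1
      (hFatou.trans_lt ENNReal.ofReal_lt_top).ne
  have hlogint : Integrable (fun x => Real.log (a x)) (μ.restrict G) := by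
    refine ((hint 0).sub hdint).congr (ae_of_all _ fun x => ?_)
    simp
  refine ⟨hapos, hlogint, ?_⟩
  rw [← ofReal_integral_eq_lintegral_ofReal hdint hnn, integral_sub (hint 0) hlogint,
    ENNReal.ofReal_le_ofReal_iff (hpos 0)] at hFatou
  linarith

/-- If the products of `a` along almost all orbits decay exponentially, then almost every orbit
has exponential decay at one of the rates `logRate`. -/
theorem ae_exists_mem_birkhoffLimsupLE_logRate
    (ha : Measurable a) (hb : Measurable b) (he : ∀ k, Measurable (e k))
    (ha0 : ∀ x, 0 ≤ a x) (hb0 : ∀ x, 0 ≤ b x) (he0 : ∀ k x, e k x < 0)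
    (hai : Integrable (fun x => Real.posLog (a x)) μ)
    (hbi : Integrable (fun x => Real.posLog (b x)) μ)
    (hT : MeasurePreserving T μ μ)
    (hprod : ∀ᵐ x ∂μ, ∃ ρ : ℝ, 0 < ρ ∧ ρ < 1 ∧
      ∀ᶠ n : ℕ in atTop, ∏ i ∈ Finset.range n, a (T^[i] x) ≤ ρ ^ n) :
    ∀ᵐ x ∂μ, ∃ k l i : ℕ, x ∈ birkhoffLimsupLE T
      (fun x => logRate (a x) (b x) (e k x) k l) (-(1 / ((i : ℝ) + 1))) := by
  have hm : ∀ k l, Measurable (fun x => logRate (a x) (b x) (e k x) k l) := fun k l => by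
    unfold logRate Real.posLog
    have := he k
    fun_prop
  have hlm : Measurable (fun x => Real.log (a x)) := by fun_prop
  set B : Set α := {x | ∃ k l i : ℕ, x ∈ birkhoffLimsupLE T
      (fun x => logRate (a x) (b x) (e k x) k l) (-(1 / ((i : ℝ) + 1)))} with hB
  have hBm : MeasurableSet B := by
    simp only [hB, Set.ofPred_exists]
    exact MeasurableSet.iUnion fun k => MeasurableSet.iUnion fun l => MeasurableSet.iUnion fun i =>
      measurableSet_birkhoffLimsupLE hT.measurable (hm k l)
  have hBT : ∀ x, T x ∈ B ↔ x ∈ B := fun x => by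
    simp only [hB, Set.mem_ofPred_eq, apply_mem_birkhoffLimsupLE_iff]
  set D : ℕ → Set α := fun j =>
    birkhoffLimsupLE T (fun x => Real.log (a x)) (-(1 / ((j : ℝ) + 1))) with hD
  have hDm : ∀ j, MeasurableSet (D j) := fun j => measurableSet_birkhoffLimsupLE hT.measurable hlm
  -- On this set the sums of log a are eventually below -(3/4) c n, so those of -log a - c/2 become
  -- positive. The maximal theorem gives ∫ log a ≤ -(c/2) μ, while ∫ log a ≥ 0.
  have hnull : ∀ j, μ (Bᶜ ∩ D j) = 0 := by
    intro j
    have hGm : MeasurableSet (Bᶜ ∩ D j) := hBm.compl.inter (hDm j)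
    have hGT : ∀ x, T x ∈ Bᶜ ∩ D j ↔ x ∈ Bᶜ ∩ D j := fun x => by
      simp only [Set.mem_inter_iff, Set.mem_compl_iff, hBT, hD, apply_mem_birkhoffLimsupLE_iff]
    obtain ⟨-, hint, hnn⟩ := setIntegral_log_nonneg ha hb ha0 hb0 hai hbi
      (setIntegral_logRateLim_nonneg ha hb he ha0 hb0 he0 hai hbi hT hGm hGT
        fun x hx k l i hxi => hx.1 ⟨k, l, i, hxi⟩)
    set c : ℝ := 1 / ((j : ℝ) + 1) with hc
    have hcpos : 0 < c := by positivity
    have h := setIntegral_nonneg_of_birkhoffSum_pos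
      (f := fun x => -Real.log (a x) - c / 2) hT hGm hGT
      ((integrable_indicator_iff hGm).2 (hint.neg.sub (integrable_const _).integrableOn))
      (hlm.neg.sub_const _) ?_
    · have hneg : IntegrableOn (fun x => -Real.log (a x)) (Bᶜ ∩ D j) μ := hint.neg
      rw [integral_sub hneg (integrable_const _).integrableOn, integral_neg, setIntegral_const,
        smul_eq_mul] at h
      have h1 : μ.real (Bᶜ ∩ D j) = 0 := by
        have := measureReal_nonneg (μ := μ) (s := Bᶜ ∩ D j)
        nlinarith
      rwa [measureReal_eq_zero_iff] at h1
    · rintro x ⟨-, hx⟩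
      have h2 := mem_birkhoffLimsupLE_iff.1 hx (-(3 / 4 * c)) (by linarith)
      obtain ⟨n, hn, hn1⟩ := (h2.and (eventually_gt_atTop 0)).exists
      refine ⟨n, ?_⟩
      have h4 : birkhoffSum T (fun x => -Real.log (a x) - c / 2) n x =
          -birkhoffSum T (fun x => Real.log (a x)) n x - c / 2 * n := by
        simp [birkhoffSum, Finset.sum_sub_distrib, mul_comm]
      have hn' : (0 : ℝ) < n := by exact_mod_cast hn1
      rw [h4]
      nlinarith
  -- Positivity of a along the orbit must come before taking logarithms: a vanishing product would
  -- be invisible to the sum, since `Real.log 0 = 0`.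
  obtain ⟨hapos, -, -⟩ := setIntegral_log_nonneg ha hb ha0 hb0 hai hbi
      (setIntegral_logRateLim_nonneg ha hb he ha0 hb0 he0 hai hbi hT hBm.compl
        (fun x => not_congr (hBT x)) fun x hx k l i hxi => hx ⟨k, l, i, hxi⟩)
  rw [ae_restrict_iff' hBm.compl] at hapos
  have hall : ∀ᵐ x ∂μ, ∀ i : ℕ, T^[i] x ∈ Bᶜ → 0 < a (T^[i] x) := ae_all_iff.2 fun i =>
    (hT.iterate i).quasiMeasurePreserving.ae hapos
  have hBit : ∀ (i : ℕ) x, T^[i] x ∈ B ↔ x ∈ B := by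
    intro i
    induction i with
    | zero => intro x; rfl
    | succ i ih => intro x; rw [Function.iterate_succ_apply, ih, hBT]
  have hnull' : ∀ᵐ x ∂μ, ∀ j, x ∉ Bᶜ ∩ D j := ae_all_iff.2 fun j => by
    exact measure_eq_zero_iff_ae_notMem.1 (hnull j)
  filter_upwards [hprod, hall, hnull'] with x ⟨ρ, hρ0, hρ1, hρ⟩ hxa hxn
  by_contra hxB
  have hxpos : ∀ i, 0 < a (T^[i] x) := fun i => hxa i fun h => hxB ((hBit i x).1 h)
  obtain ⟨j, hj⟩ := exists_nat_one_div_lt (neg_pos.2 (Real.log_neg hρ0 hρ1))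
  refine hxn j ⟨hxB, mem_birkhoffLimsupLE_iff.2 fun d hd => ?_⟩
  filter_upwards [hρ] with n hn
  rw [birkhoffSum_log_eq_log_prod x n hxpos]
  have h1 := Real.log_le_log (Finset.prod_pos fun i _ => hxpos i) hn
  rw [Real.log_pow] at h1
  have : (0 : ℝ) ≤ n := n.cast_nonneg
  nlinarith

end Ergodic

/-! ### One-step contraction from drift and minorization. -/

section Contraction

variable {E F : Type*} [MeasurableSpace E] [MeasurableSpace F]

/-- The family of kernels `P_x` satisfies the drift condition with coefficients `lam`, `b`, and
the level sets `{V ≤ (k + 1) ^ 2}` are small, with minorizing constants `η k x`. -/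
structure DriftMinorization (P : Kernel (F × E) E) (V : E → ℝ) (lam b : F → ℝ≥0)
    (η : ℕ → F → ℝ) : Prop where
  measurable_V : Measurable V
  V_pos : ∀ y, 0 < V y
  measurable_lam : Measurable lam
  measurable_b : Measurable b
  drift : ∀ x y, ∫⁻ y', ENNReal.ofReal (V y') ∂(P (x, y)) ≤
    (lam x : ℝ≥0∞) * ENNReal.ofReal (V y) + (b x : ℝ≥0∞)
  measurable_eta : ∀ k, Measurable (η k)
  eta_pos : ∀ k x, 0 < η k x
  eta_lt_one : ∀ k x, η k x < 1
  minorization : ∀ k : ℕ, ∃ ν : Kernel F E, IsMarkovKernel ν ∧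
    ∀ x y, V y ≤ ((k : ℝ) + 1) ^ 2 → ENNReal.ofReal (η k x) • ν x ≤ P (x, y)

/-- Two finite measures with the same mass `m` integrate `φ` to nearly the same value if `φ` has
oscillation controlled by a power of the weight `1 + β (V u + V v)`. -/
lemma abs_integral_sub_integral_le {μ ν : Measure E} [IsFiniteMeasure μ] [IsFiniteMeasure ν]
    {V φ : E → ℝ} {c β q s t m : ℝ} (hV : Measurable V) (hV0 : ∀ y, 0 ≤ V y) (hφ : Measurable φ)
    (hφ0 : ∀ y, 0 ≤ φ y) (hφ1 : ∀ y, φ y ≤ 1) (hc : 0 ≤ c) (hβ : 0 ≤ β) (hq0 : 0 ≤ q)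
    (hq1 : q ≤ 1) (hm0 : 0 < m) (hm1 : m ≤ 1) (hμ : μ.real Set.univ = m)
    (hν : ν.real Set.univ = m) (hs0 : 0 ≤ s) (ht0 : 0 ≤ t)
    (hs : ∫⁻ y, ENNReal.ofReal (V y) ∂μ ≤ ENNReal.ofReal s)
    (ht : ∫⁻ y, ENNReal.ofReal (V y) ∂ν ≤ ENNReal.ofReal t)
    (hosc : ∀ u v, |φ u - φ v| ≤ c * (1 + β * (V u + V v)) ^ q) :
    |∫ y, φ y ∂μ - ∫ y, φ y ∂ν| ≤ c * (m ^ (1 - q) * (1 + β * (s + t)) ^ q) := by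
  have hμe : μ Set.univ = ENNReal.ofReal m := by rw [← hμ, ofReal_measureReal]
  have hνe : ν Set.univ = ENNReal.ofReal m := by rw [← hν, ofReal_measureReal]
  have hφi : ∀ ρ : Measure E, IsFiniteMeasure ρ → Integrable φ ρ := fun ρ _ =>
    Integrable.of_bound hφ.aestronglyMeasurable 1 (ae_of_all _ fun y => by
      rw [Real.norm_eq_abs, abs_of_nonneg (hφ0 y)]; exact hφ1 y)
  -- The independent coupling has mass m², hence the extra factor m, divided out at the end.
  have hprod : m * (∫ y, φ y ∂μ - ∫ y, φ y ∂ν) = ∫ z, (φ z.1 - φ z.2) ∂(μ.prod ν) := by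
    rw [integral_sub ((hφi μ inferInstance).comp_fst ν) ((hφi ν inferInstance).comp_snd μ),
      integral_fun_fst, integral_fun_snd, hμ, hν]
    simp only [smul_eq_mul]; ring
  have hW : ∫⁻ z, ENNReal.ofReal (1 + β * (V z.1 + V z.2)) ∂(μ.prod ν) ≤
      ENNReal.ofReal (m * (1 + β * (s + t))) := by
    have h1 : ∀ z : E × E, ENNReal.ofReal (1 + β * (V z.1 + V z.2)) =
        1 + ENNReal.ofReal β * (ENNReal.ofReal (V z.1) + ENNReal.ofReal (V z.2)) := fun z => by
      rw [ENNReal.ofReal_add zero_le_one (mul_nonneg hβ (add_nonneg (hV0 _) (hV0 _))),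
        ENNReal.ofReal_mul hβ, ENNReal.ofReal_add (hV0 _) (hV0 _), ENNReal.ofReal_one]
    simp_rw [h1]
    rw [lintegral_add_left measurable_const, lintegral_const_mul _ (by fun_prop),
      lintegral_add_left (by fun_prop), lintegral_const, Measure.prod_apply MeasurableSet.univ]
    have h2 : ∫⁻ z : E × E, ENNReal.ofReal (V z.1) ∂(μ.prod ν) =
        ENNReal.ofReal m * ∫⁻ y, ENNReal.ofReal (V y) ∂μ := by
      rw [lintegral_prod _ (by fun_prop)]
      simp only [lintegral_const, hνe, mul_comm _ (ENNReal.ofReal m)]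
      exact lintegral_const_mul _ hV.ennreal_ofReal
    have h3 : ∫⁻ z : E × E, ENNReal.ofReal (V z.2) ∂(μ.prod ν) =
        ENNReal.ofReal m * ∫⁻ y, ENNReal.ofReal (V y) ∂ν := by
      rw [lintegral_prod _ (by fun_prop)]
      simp [hμe, mul_comm]
    rw [h2, h3]
    simp only [Set.preimage_univ, lintegral_const, hμe, hνe, one_mul]
    calc _ ≤ ENNReal.ofReal m * ENNReal.ofReal m + ENNReal.ofReal β *
          (ENNReal.ofReal m * ENNReal.ofReal s + ENNReal.ofReal m * ENNReal.ofReal t) := by gcongr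
      _ = ENNReal.ofReal (m * m + β * (m * s + m * t)) := by
          rw [ENNReal.ofReal_add (by positivity) (by positivity), ENNReal.ofReal_mul hβ,
            ENNReal.ofReal_add (by positivity) (by positivity), ENNReal.ofReal_mul hm0.le,
            ENNReal.ofReal_mul hm0.le, ENNReal.ofReal_mul hm0.le]
      _ ≤ _ := ENNReal.ofReal_le_ofReal (by nlinarith)
  -- Hölder with exponents 1/q and 1/(1-q) against the constant 1; the mass to the power 1 - q
  -- carries the gain from minorization.
  have hHolder : ∫⁻ z, ENNReal.ofReal (1 + β * (V z.1 + V z.2)) ^ q ∂(μ.prod ν) ≤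
      ENNReal.ofReal ((m * (1 + β * (s + t))) ^ q * (m * m) ^ (1 - q)) := by
    have h := ENNReal.lintegral_mul_norm_pow_le (μ := μ.prod ν)
      (f := fun z => ENNReal.ofReal (1 + β * (V z.1 + V z.2))) (g := fun _ => 1)
      (by fun_prop) (by fun_prop) hq0 (sub_nonneg.2 hq1) (by ring)
    simp only [ENNReal.one_rpow, mul_one, lintegral_const, one_mul] at h
    refine h.trans ?_
    have hu : (μ.prod ν) Set.univ = ENNReal.ofReal (m * m) := by
      rw [← Set.univ_prod_univ, Measure.prod_prod, hμe, hνe, ENNReal.ofReal_mul hm0.le]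
    rw [hu, ENNReal.ofReal_mul (p := (m * (1 + β * (s + t))) ^ q) (by positivity), ← ENNReal.ofReal_rpow_of_nonneg (by positivity) hq0,
      ← ENNReal.ofReal_rpow_of_nonneg (by positivity) (sub_nonneg.2 hq1)]
    gcongr
  have habs : ENNReal.ofReal |m * (∫ y, φ y ∂μ - ∫ y, φ y ∂ν)| ≤
      ENNReal.ofReal (c * ((m * (1 + β * (s + t))) ^ q * (m * m) ^ (1 - q))) := by
    rw [hprod, ← Real.norm_eq_abs, ofReal_norm]
    refine (enorm_integral_le_lintegral_enorm _).trans ?_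
    rw [ENNReal.ofReal_mul hc]
    refine le_trans ?_ (mul_le_mul_right hHolder _)
    rw [← lintegral_const_mul _ (by fun_prop)]
    refine lintegral_mono fun z => ?_
    have h0 : 0 ≤ 1 + β * (V z.1 + V z.2) := by
      have := hV0 z.1; have := hV0 z.2; positivity
    rw [ENNReal.ofReal_rpow_of_nonneg h0 hq0, ← ENNReal.ofReal_mul hc, ← ofReal_norm,
      Real.norm_eq_abs]
    exact ENNReal.ofReal_le_ofReal (hosc _ _)
  rw [ENNReal.ofReal_le_ofReal_iff (by positivity), abs_mul, abs_of_pos hm0] at habs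
  have hmm : (m * (1 + β * (s + t))) ^ q * (m * m) ^ (1 - q) =
      m * (m ^ (1 - q) * (1 + β * (s + t)) ^ q) := by
    have h1 : m ^ q * m ^ (1 - q) = m := by
      rw [← Real.rpow_add hm0]; simp
    rw [Real.mul_rpow hm0.le (by positivity), Real.mul_rpow hm0.le hm0.le]
    linear_combination (m ^ (1 - q) * (1 + β * (s + t)) ^ q) * h1
  rw [hmm, mul_left_comm] at habs
  exact le_of_mul_le_mul_left habs hm0

lemma exp_logRate {a b u : ℝ} (ha : 0 ≤ a) (hb : 0 ≤ b) (hu : 0 < u) (k l : ℕ) :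
    Real.exp (logRate a b (Real.log u) k l) =
      (1 + 2 * b / ((k : ℝ) + 1)) * max (a + 1 / ((k : ℝ) + 2)) (max 1 a * u ^ l) := by
  rw [logRate, Real.exp_add, Real.exp_log (by positivity), Real.exp_monotone.map_max,
    Real.exp_log (by positivity), Real.exp_add, Real.posLog_eq_log_max_one ha,
    Real.exp_log (by positivity), ← Real.log_pow, Real.exp_log (by positivity)]

/-- Inside the level set the factor u ^ l is gained, so the crude bound `max 1 a` on the drift
suffices. -/
lemma mul_le_exp_logRate_mul_of_le {a b u W : ℝ} (ha : 0 ≤ a) (hb : 0 ≤ b) (hu : 0 < u)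
    (hW : 0 ≤ W) (k l : ℕ) :
    u ^ l * (1 + 1 / ((k : ℝ) + 1) * (a * W + 2 * b)) ≤
      Real.exp (logRate a b (Real.log u) k l) * (1 + 1 / ((k : ℝ) + 1) * W) := by
  rw [exp_logRate ha hb hu]
  set β : ℝ := 1 / ((k : ℝ) + 1) with hβ
  have hβ0 : 0 ≤ β := by positivity
  have h2 : 2 * b / ((k : ℝ) + 1) = 2 * b * β := by rw [hβ]; ring
  rw [h2]
  calc u ^ l * (1 + β * (a * W + 2 * b))
      ≤ u ^ l * ((1 + 2 * b * β) * (max 1 a * (1 + β * W))) := by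
        gcongr
        have h3 : a * (β * W) ≤ max 1 a * (β * W) := by gcongr; exact le_max_right _ _
        have h4 := le_max_left 1 a
        have h5 : 0 ≤ b * β := by positivity
        have h6 : 0 ≤ β * W := by positivity
        have h7 : 1 + a * (β * W) ≤ max 1 a * (1 + β * W) := by linarith
        have h8 : 1 ≤ max 1 a * (1 + β * W) := by nlinarith [mul_nonneg ha h6]
        nlinarith
    _ = (1 + 2 * b * β) * (max 1 a * u ^ l) * (1 + β * W) := by ring
    _ ≤ _ := by gcongr; exact le_max_right _ _

/-- Here W/(k+1) ≥ k+1, so the constant 1 is at most 1/(k+2) of the weight. -/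
lemma le_exp_logRate_mul_of_lt {a b u W : ℝ} (ha : 0 ≤ a) (hb : 0 ≤ b) (hu : 0 < u)
    (k l : ℕ) (hW : ((k : ℝ) + 1) ^ 2 ≤ W) :
    1 + 1 / ((k : ℝ) + 1) * (a * W + 2 * b) ≤
      Real.exp (logRate a b (Real.log u) k l) * (1 + 1 / ((k : ℝ) + 1) * W) := by
  rw [exp_logRate ha hb hu]
  have hW0 : 0 ≤ W := le_trans (by positivity) hW
  have hβW : (k : ℝ) + 1 ≤ 1 / ((k : ℝ) + 1) * W := by
    rw [div_mul_eq_mul_div, one_mul, le_div_iff₀ (by positivity)]; nlinarith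
  set β : ℝ := 1 / ((k : ℝ) + 1) with hβ
  have hβ0 : 0 ≤ β := by positivity
  have h2 : 2 * b / ((k : ℝ) + 1) = 2 * b * β := by rw [hβ]; ring
  rw [h2]
  have h3 : 1 + a * (β * W) ≤ (a + 1 / ((k : ℝ) + 2)) * (1 + β * W) := by
    have : 1 ≤ 1 / ((k : ℝ) + 2) * (1 + β * W) := by
      rw [div_mul_eq_mul_div, one_mul, le_div_iff₀ (by positivity)]; linarith
    linarith
  calc 1 + β * (a * W + 2 * b) ≤ (1 + 2 * b * β) * (1 + a * (β * W)) := by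
        have : 0 ≤ (2 * b * β) * (a * (β * W)) := by positivity
        linarith
    _ ≤ (1 + 2 * b * β) * ((a + 1 / ((k : ℝ) + 2)) * (1 + β * W)) := by gcongr
    _ = (1 + 2 * b * β) * (a + 1 / ((k : ℝ) + 2)) * (1 + β * W) := by ring
    _ ≤ _ := by gcongr; exact le_max_left _ _

variable {P : Kernel (F × E) E} {V : E → ℝ} {lam b : F → ℝ≥0} {η : ℕ → F → ℝ}

lemma DriftMinorization.drift_ofReal (h : DriftMinorization P V lam b η) (x : F) (y : E) :
    ∫⁻ y', ENNReal.ofReal (V y') ∂(P (x, y)) ≤ ENNReal.ofReal (lam x * V y + b x) := by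
  refine (h.drift x y).trans_eq ?_
  have := (h.V_pos y).le
  rw [ENNReal.ofReal_add (by positivity) (by positivity), ENNReal.ofReal_mul (by positivity)]
  simp

variable [IsMarkovKernel P]

/-- The rate `logRate` at the environment `x`. -/
noncomputable def envRate (lam b : F → ℝ≥0) (η : ℕ → F → ℝ) (k l : ℕ) (x : F) : ℝ :=
  logRate (lam x) (b x) (Real.log (1 - η k x)) k l

/-- One-step contraction of the seminorm attached to `(1 + (V y + V y') / (k + 1)) ^ (1 / (l + 1))`.
-/
lemma DriftMinorization.abs_integral_sub_le (h : DriftMinorization P V lam b η) (k l : ℕ) (x : F)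
    {φ : E → ℝ} {c : ℝ} (hφ : Measurable φ)
    (hφ0 : ∀ y, 0 ≤ φ y) (hφ1 : ∀ y, φ y ≤ 1) (hc : 0 ≤ c)
    (hosc : ∀ u v, |φ u - φ v| ≤
      c * (1 + 1 / ((k : ℝ) + 1) * (V u + V v)) ^ (1 / ((l : ℝ) + 1))) (y y' : E) :
    |∫ u, φ u ∂(P (x, y)) - ∫ u, φ u ∂(P (x, y'))| ≤
      c * Real.exp (envRate lam b η k l x / ((l : ℝ) + 1)) *
        (1 + 1 / ((k : ℝ) + 1) * (V y + V y')) ^ (1 / ((l : ℝ) + 1)) := by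
  set q : ℝ := 1 / ((l : ℝ) + 1) with hq
  set β : ℝ := 1 / ((k : ℝ) + 1) with hβ
  have hβ0 : 0 ≤ β := by positivity
  have hq0 : 0 ≤ q := by positivity
  have hq1 : q ≤ 1 := by
    rw [hq, div_le_one (by positivity)]; linarith [l.cast_nonneg (α := ℝ)]
  have hu : 0 < 1 - η k x := sub_pos.2 (h.eta_lt_one k x)
  have hVy := h.V_pos y
  have hVy' := h.V_pos y'
  have hexp : Real.exp (envRate lam b η k l x / ((l : ℝ) + 1)) =
      Real.exp (envRate lam b η k l x) ^ q := by
    rw [← Real.exp_mul, hq, mul_one_div]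
  have hL : β * ((lam x * V y + b x) + (lam x * V y' + b x)) =
      β * (lam x * (V y + V y') + 2 * b x) := by ring
  rw [mul_assoc, hexp, ← Real.mul_rpow (Real.exp_nonneg _) (by positivity)]
  by_cases hW : V y + V y' ≤ ((k : ℝ) + 1) ^ 2
  · obtain ⟨ν, hν, hmin⟩ := h.minorization k
    have hmy := hmin x y (by linarith)
    have hmy' := hmin x y' (by linarith)
    -- The same ρ lies below both transition laws, so it cancels and leaves two measures of mass 1 -
    -- η.
    set ρ : Measure E := ENNReal.ofReal (η k x) • ν x with hρ
    have hρf : IsFiniteMeasure ρ := ⟨by simp [hρ]⟩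
    have hmass : ∀ w, ρ ≤ P (x, w) → (P (x, w) - ρ).real Set.univ = 1 - η k x := fun w hw => by
      have h1 : (P (x, w) - ρ + ρ).real Set.univ = 1 := by
        rw [Measure.sub_add_cancel_of_le hw]; simp
      have h2 : ρ.real Set.univ = η k x := by simp [hρ, (h.eta_pos k x).le]
      rw [measureReal_add_apply, h2] at h1
      linarith
    have hφi : ∀ κ : Measure E, IsFiniteMeasure κ → Integrable φ κ := fun κ _ =>
      Integrable.of_bound hφ.aestronglyMeasurable 1 (ae_of_all _ fun y => by
        rw [Real.norm_eq_abs, abs_of_nonneg (hφ0 y)]; exact hφ1 y)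
    have hint : ∀ w, ρ ≤ P (x, w) →
        ∫ u, φ u ∂(P (x, w)) = ∫ u, φ u ∂(P (x, w) - ρ) + ∫ u, φ u ∂ρ := fun w hw => by
      rw [← integral_add_measure (hφi _ inferInstance) (hφi _ inferInstance),
        Measure.sub_add_cancel_of_le hw]
    rw [hint y hmy, hint y' hmy', add_sub_add_right_eq_sub]
    refine (abs_integral_sub_integral_le h.measurable_V (fun y => (h.V_pos y).le) hφ hφ0 hφ1 hc hβ0
      hq0 hq1 hu (by linarith [h.eta_pos k x]) (hmass y hmy) (hmass y' hmy')
      (s := lam x * V y + b x) (t := lam x * V y' + b x) (by positivity) (by positivity)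
      ((lintegral_mono' Measure.sub_le le_rfl).trans (h.drift_ofReal x y))
      ((lintegral_mono' Measure.sub_le le_rfl).trans (h.drift_ofReal x y')) hosc).trans ?_
    gcongr
    -- Since 1 - q = l q, the factor is a q-th power and merges with the weight.
    have h3 : (1 - η k x) ^ (1 - q) = ((1 - η k x) ^ l) ^ q := by
      rw [← Real.rpow_natCast, ← Real.rpow_mul hu.le]
      congr 1
      rw [hq]; field_simp; ring
    rw [h3, hL, ← Real.mul_rpow (by positivity) (by positivity)]
    exact Real.rpow_le_rpow (by positivity)
      (mul_le_exp_logRate_mul_of_le (by positivity) (by positivity) hu (by positivity) k l) hq0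
  · refine (abs_integral_sub_integral_le h.measurable_V (fun y => (h.V_pos y).le) hφ hφ0 hφ1 hc hβ0
      hq0 hq1 one_pos le_rfl (by simp) (by simp)
      (s := lam x * V y + b x) (t := lam x * V y' + b x) (by positivity) (by positivity)
      (h.drift_ofReal x y) (h.drift_ofReal x y') hosc).trans ?_
    rw [Real.one_rpow, one_mul, hL]
    gcongr
    exact le_exp_logRate_mul_of_lt (by positivity) (by positivity) hu k l (not_le.1 hW).le

end Contraction

/-! ### Contracting environments. -/

section Contracting

variable {F : Type*} {lam b : F → ℝ≥0} {η : ℕ → F → ℝ}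

/-- The contraction coefficient of `P_{p_{n-1}} ⋯ P_{p_0}`. -/
noncomputable def contractionCoeff (lam b : F → ℝ≥0) (η : ℕ → F → ℝ) (k l : ℕ) (p : ℕ → F)
    (n : ℕ) : ℝ :=
  Real.exp ((∑ i ∈ Finset.range n, envRate lam b η k l (p i)) / ((l : ℝ) + 1))

/-- Geometric contraction along the environment `p`, with room for the drift coefficients. -/
def IsContracting (lam b : F → ℝ≥0) (η : ℕ → F → ℝ) (k l j M : ℕ) (p : ℕ → F) : Prop :=
  ∀ n : ℕ, contractionCoeff lam b η k l p n * (1 + lam (p n) + b (p n)) ≤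
    M * Real.exp (-(1 / ((j : ℝ) + 1))) ^ n

lemma IsContracting.coeff_le {k l j M : ℕ} {p : ℕ → F} (hp : IsContracting lam b η k l j M p)
    (n : ℕ) : contractionCoeff lam b η k l p n ≤ M * Real.exp (-(1 / ((j : ℝ) + 1))) ^ n := by
  refine le_trans ?_ (hp n)
  have h1 : 0 ≤ contractionCoeff lam b η k l p n := Real.exp_nonneg _
  have h2 : (0 : ℝ) ≤ lam (p n) := by positivity
  have h3 : (0 : ℝ) ≤ b (p n) := by positivity
  nlinarith [mul_nonneg h1 h2, mul_nonneg h1 h3]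

end Contracting

/-! ### Backward kernels and their limits. -/

section BackwardKernel

variable {E F : Type*} [MeasurableSpace E] [MeasurableSpace F] {P : Kernel (F × E) E}

/-- The kernel `(x, z) ↦ δ_z P_{x_{n-1}} ⋯ P_{x_0}`. -/
noncomputable def backwardKernel (P : Kernel (F × E) E) : ℕ → Kernel ((ℕ → F) × E) E
  | 0 => Kernel.deterministic Prod.snd measurable_snd
  | n + 1 => backwardKernel P n ∘ₖ (Kernel.deterministic Prod.fst measurable_fst ×ₖ
      P.comap (fun z : (ℕ → F) × E => (z.1 n, z.2)) (by fun_prop))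

instance isMarkovKernel_backwardKernel [IsMarkovKernel P] (n : ℕ) :
    IsMarkovKernel (backwardKernel P n) := by
  induction n with
  | zero => rw [backwardKernel]; infer_instance
  | succ n ih => rw [backwardKernel]; infer_instance

lemma backwardKernel_zero (p : ℕ → F) (z : E) : backwardKernel P 0 (p, z) = Measure.dirac z := by
  rw [backwardKernel, Kernel.deterministic_apply]

lemma measurable_backwardKernel (p : ℕ → F) (n : ℕ) :
    Measurable (fun y => backwardKernel P n (p, y)) :=
  (backwardKernel P n).measurable.comp measurable_prodMk_left

lemma backwardKernel_succ [IsMarkovKernel P] (n : ℕ) (p : ℕ → F) (z : E) :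
    backwardKernel P (n + 1) (p, z) =
      (P (p n, z)).bind (fun y => backwardKernel P n (p, y)) := by
  ext A hA
  rw [backwardKernel, Kernel.comp_apply' _ _ _ hA, Kernel.prod_apply, Kernel.deterministic_apply,
    Kernel.comap_apply, lintegral_prod _ (Kernel.measurable_coe _ hA).aemeasurable,
    lintegral_dirac', Measure.bind_apply hA (measurable_backwardKernel p n).aemeasurable]
  exact (Kernel.measurable_coe _ hA).lintegral_prod_right'

lemma backwardIter_eq_bind [IsMarkovKernel P] (p : ℕ → F) (n : ℕ) (μ : Measure E) :
    backwardIter P p n μ = μ.bind (fun y => backwardKernel P n (p, y)) := by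
  induction n generalizing μ with
  | zero => simp [backwardIter, backwardKernel_zero]
  | succ n ih =>
    rw [backwardIter, ih, stepMeasure, Measure.bind_bind (P.sectR (p n)).measurable.aemeasurable
      (measurable_backwardKernel p n).aemeasurable]
    simp_rw [backwardKernel_succ]
    rfl

lemma backwardIter_dirac [IsMarkovKernel P] (p : ℕ → F) (n : ℕ) (z : E) :
    backwardIter P p n (Measure.dirac z) = backwardKernel P n (p, z) := by
  rw [backwardIter_eq_bind, Measure.dirac_bind (measurable_backwardKernel p n)]

lemma measureReal_bind {μ : Measure E} {κ : E → Measure E} (hκ : Measurable κ)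
    (hκ1 : ∀ y, IsProbabilityMeasure (κ y)) {A : Set E} (hA : MeasurableSet A) :
    (μ.bind κ).real A = ∫ y, (κ y).real A ∂μ := by
  rw [measureReal_def, Measure.bind_apply hA hκ.aemeasurable]
  exact (integral_toReal (f := fun y => κ y A)
    ((Measure.measurable_coe hA).comp hκ).aemeasurable
    (ae_of_all _ fun y => measure_lt_top _ _)).symm

lemma measurable_backwardKernel_real (p : ℕ → F) (n : ℕ) {A : Set E} (hA : MeasurableSet A) :
    Measurable (fun y => (backwardKernel P n (p, y)).real A) :=
  ((Measure.measurable_coe hA).comp (measurable_backwardKernel p n)).ennreal_toReal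

lemma backwardKernel_succ_real [IsMarkovKernel P] (n : ℕ) (p : ℕ → F) (z : E) {A : Set E}
    (hA : MeasurableSet A) : (backwardKernel P (n + 1) (p, z)).real A =
      ∫ y, (backwardKernel P n (p, y)).real A ∂(P (p n, z)) := by
  rw [backwardKernel_succ, measureReal_bind (measurable_backwardKernel p n)
    (fun y => inferInstance) hA]

variable {V : E → ℝ} {lam b : F → ℝ≥0} {η : ℕ → F → ℝ}

lemma DriftMinorization.abs_backwardKernel_sub_le [IsMarkovKernel P] (h : DriftMinorization P V lam b η) (k l : ℕ)
    (p : ℕ → F) (n : ℕ) {A : Set E} (hA : MeasurableSet A) (y y' : E) :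
    |(backwardKernel P n (p, y)).real A - (backwardKernel P n (p, y')).real A| ≤
      contractionCoeff lam b η k l p n * (1 + (V y + V y')) := by
  -- The induction needs the exact weight with its exponent; it is weakened to 1 + V y + V y' only
  -- afterwards.
  suffices H : ∀ y y', |(backwardKernel P n (p, y)).real A - (backwardKernel P n (p, y')).real A| ≤
      contractionCoeff lam b η k l p n *
        (1 + 1 / ((k : ℝ) + 1) * (V y + V y')) ^ (1 / ((l : ℝ) + 1)) by
    refine (H y y').trans (mul_le_mul_of_nonneg_left ?_ (Real.exp_nonneg _))
    have h1 := h.V_pos y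
    have h2 := h.V_pos y'
    have hk : 1 / ((k : ℝ) + 1) ≤ 1 := by
      rw [div_le_one (by positivity)]; linarith [k.cast_nonneg (α := ℝ)]
    have hl : 1 / ((l : ℝ) + 1) ≤ 1 := by
      rw [div_le_one (by positivity)]; linarith [l.cast_nonneg (α := ℝ)]
    have h3 : 0 ≤ 1 / ((k : ℝ) + 1) * (V y + V y') := by positivity
    calc (1 + 1 / ((k : ℝ) + 1) * (V y + V y')) ^ (1 / ((l : ℝ) + 1))
        ≤ (1 + 1 / ((k : ℝ) + 1) * (V y + V y')) ^ (1 : ℝ) :=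
          Real.rpow_le_rpow_of_exponent_le (by linarith) hl
      _ ≤ 1 + (V y + V y') := by
          rw [Real.rpow_one]
          have := mul_le_mul_of_nonneg_right hk (add_pos h1 h2).le
          linarith
  induction n with
  | zero =>
    intro y y'
    have h1 := h.V_pos y
    have h2 := h.V_pos y'
    have h3 : 0 ≤ 1 / ((k : ℝ) + 1) * (V y + V y') := by positivity
    simp only [contractionCoeff, Finset.range_zero, Finset.sum_empty, zero_div, Real.exp_zero,
      one_mul]
    refine le_trans ?_ (Real.one_le_rpow (by linarith) (by positivity))
    rw [abs_le]
    constructor <;> linarith [measureReal_nonneg (μ := backwardKernel P 0 (p, y)) (s := A),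
      measureReal_nonneg (μ := backwardKernel P 0 (p, y')) (s := A),
      measureReal_le_one (μ := backwardKernel P 0 (p, y)) (s := A),
      measureReal_le_one (μ := backwardKernel P 0 (p, y')) (s := A)]
  | succ n ih =>
    intro y y'
    rw [backwardKernel_succ_real n p y hA, backwardKernel_succ_real n p y' hA]
    have hstep := h.abs_integral_sub_le k l (p n) (measurable_backwardKernel_real (P := P) p n hA)
      (fun y => measureReal_nonneg) (fun y => measureReal_le_one)
      (Real.exp_nonneg ((∑ i ∈ Finset.range n, envRate lam b η k l (p i)) / ((l : ℝ) + 1)))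
      ih y y'
    rwa [← Real.exp_add, ← add_div, ← Finset.sum_range_succ] at hstep

lemma DriftMinorization.measurable_envRate (h : DriftMinorization P V lam b η) (k l : ℕ) :
    Measurable (envRate lam b η k l) := by
  have h1 := h.measurable_lam
  have h2 := h.measurable_b
  have h3 := h.measurable_eta k
  unfold envRate logRate Real.posLog
  fun_prop

lemma DriftMinorization.measurableSet_isContracting (h : DriftMinorization P V lam b η)
    (k l j M : ℕ) : MeasurableSet {p | IsContracting lam b η k l j M p} := by
  have h1 := h.measurable_lam
  have h2 := h.measurable_b
  have h3 := h.measurable_envRate k l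
  simp only [IsContracting, Set.ofPred_forall]
  refine MeasurableSet.iInter fun n => measurableSet_le ?_ measurable_const
  unfold contractionCoeff
  fun_prop

variable [IsMarkovKernel P]

/-- The longer iterate starts n steps from a point y drawn from P (p n, z) instead of z. Averaging
the contraction bound over y costs ∫ V dP, hence the factor 1 + lam + b in `IsContracting`. -/
lemma DriftMinorization.abs_backwardKernel_succ_sub_le (h : DriftMinorization P V lam b η)
    {k l j M : ℕ} {p : ℕ → F} (hp : IsContracting lam b η k l j M p) (n : ℕ)
    {A : Set E} (hA : MeasurableSet A) (z : E) :
    |(backwardKernel P (n + 1) (p, z)).real A - (backwardKernel P n (p, z)).real A| ≤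
      M * (1 + V z) * Real.exp (-(1 / ((j : ℝ) + 1))) ^ n := by
  have hVz := h.V_pos z
  have hc : 0 ≤ contractionCoeff lam b η k l p n := Real.exp_nonneg _
  have hfin : ∫⁻ y, ENNReal.ofReal (V y) ∂(P (p n, z)) ≠ ∞ :=
    ((h.drift_ofReal (p n) z).trans_lt ENNReal.ofReal_lt_top).ne
  have hVi : Integrable V (P (p n, z)) :=
    (lintegral_ofReal_ne_top_iff_integrable h.measurable_V.aestronglyMeasurable
      (ae_of_all _ fun y => (h.V_pos y).le)).1 hfin
  have hVint : ∫ y, V y ∂(P (p n, z)) ≤ lam (p n) * V z + b (p n) := by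
    rw [integral_eq_lintegral_of_nonneg_ae (ae_of_all _ fun y => (h.V_pos y).le)
      h.measurable_V.aestronglyMeasurable]
    exact ENNReal.toReal_le_of_le_ofReal (by positivity) (h.drift_ofReal (p n) z)
  have hφi : Integrable (fun y => (backwardKernel P n (p, y)).real A) (P (p n, z)) :=
    Integrable.of_bound (measurable_backwardKernel_real p n hA).aestronglyMeasurable 1
      (ae_of_all _ fun y => by
        rw [Real.norm_eq_abs, abs_of_nonneg measureReal_nonneg]; exact measureReal_le_one)
  have hsub : (backwardKernel P (n + 1) (p, z)).real A - (backwardKernel P n (p, z)).real A =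
      ∫ y, ((backwardKernel P n (p, y)).real A - (backwardKernel P n (p, z)).real A)
        ∂(P (p n, z)) := by
    rw [integral_sub hφi (integrable_const _), backwardKernel_succ_real n p z hA]
    simp
  rw [hsub]
  have hVz_int : Integrable (fun y => V y + V z) (P (p n, z)) := hVi.add (integrable_const _)
  have hgi : Integrable (fun y => contractionCoeff lam b η k l p n * (1 + (V y + V z)))
      (P (p n, z)) := ((integrable_const 1).add hVz_int).const_mul _
  calc |∫ y, ((backwardKernel P n (p, y)).real A - (backwardKernel P n (p, z)).real A)
        ∂(P (p n, z))|
      ≤ ∫ y, |(backwardKernel P n (p, y)).real A - (backwardKernel P n (p, z)).real A|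
        ∂(P (p n, z)) := abs_integral_le_integral_abs
    _ ≤ ∫ y, contractionCoeff lam b η k l p n * (1 + (V y + V z)) ∂(P (p n, z)) :=
        integral_mono (hφi.sub (integrable_const _)).abs hgi
          fun y => h.abs_backwardKernel_sub_le k l p n hA y z
    _ = contractionCoeff lam b η k l p n * (1 + (∫ y, V y ∂(P (p n, z)) + V z)) := by
        rw [integral_const_mul, integral_add (integrable_const _) hVz_int, integral_add hVi (integrable_const _)]
        simp
    _ ≤ contractionCoeff lam b η k l p n * ((1 + lam (p n) + b (p n)) * (1 + V z)) := by
        gcongr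
        have : 0 ≤ (b (p n) : ℝ) * V z := by positivity
        have : (0 : ℝ) ≤ lam (p n) := by positivity
        linarith
    _ ≤ M * Real.exp (-(1 / ((j : ℝ) + 1))) ^ n * (1 + V z) := by
        rw [← mul_assoc]
        exact mul_le_mul_of_nonneg_right (hp n) (by linarith)
    _ = _ := by ring

lemma abs_sub_le_of_geometric {u : ℕ → ℝ} {C r : ℝ} (hr0 : 0 ≤ r) (hr1 : r < 1) (hC : 0 ≤ C)
    (h : ∀ n, |u (n + 1) - u n| ≤ C * r ^ n) {m n : ℕ} (hnm : n ≤ m) :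
    |u m - u n| ≤ C * r ^ n / (1 - r) := by
  have h1 : (0 : ℝ) < 1 - r := sub_pos.2 hr1
  suffices H : |u m - u n| ≤ C * (r ^ n - r ^ m) / (1 - r) by
    refine H.trans ?_
    gcongr
    linarith [pow_nonneg hr0 m]
  induction m, hnm using Nat.le_induction with
  | base => simp
  | succ m hm ih =>
    have h2 : |u (m + 1) - u n| ≤ |u (m + 1) - u m| + |u m - u n| := abs_sub_le _ _ _
    refine (h2.trans (add_le_add (h m) ih)).trans_eq ?_
    field_simp
    ring

/-- A sequence of probability measures which is Cauchy uniformly on measurable sets has a limit. -/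
theorem exists_isProbabilityMeasure_of_uniform_cauchy {μ : ℕ → Measure E}
    [∀ n, IsProbabilityMeasure (μ n)] {ε : ℕ → ℝ} (hε : Tendsto ε atTop (𝓝 0))
    (h : ∀ n m, n ≤ m → ∀ A, MeasurableSet A → |(μ m).real A - (μ n).real A| ≤ ε n) :
    ∃ π : Measure E, IsProbabilityMeasure π ∧
      ∀ n A, MeasurableSet A → |(μ n).real A - π.real A| ≤ ε n := by
  have hlim : ∀ A, ∃ a : ℝ, MeasurableSet A → Tendsto (fun n => (μ n).real A) atTop (𝓝 a) := by
    intro A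
    by_cases hA : MeasurableSet A
    · have hc : CauchySeq (fun n => (μ n).real A) :=
        cauchySeq_of_le_tendsto_0' ε (fun n m hnm => by
          rw [dist_comm, Real.dist_eq]; exact h n m hnm A hA) hε
      obtain ⟨a, ha⟩ := cauchySeq_tendsto_of_complete hc
      exact ⟨a, fun _ => ha⟩
    · exact ⟨0, fun h => absurd h hA⟩
  choose g hg using hlim
  have hg0 : ∀ A, MeasurableSet A → 0 ≤ g A := fun A hA =>
    ge_of_tendsto' (hg A hA) fun n => measureReal_nonneg
  have hbound : ∀ n A, MeasurableSet A → |(μ n).real A - g A| ≤ ε n := fun n A hA => by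
    have h1 : Tendsto (fun m => |(μ m).real A - (μ n).real A|) atTop (𝓝 |g A - (μ n).real A|) :=
      ((hg A hA).sub_const _).abs
    rw [abs_sub_comm]
    exact le_of_tendsto h1 (eventually_atTop.2 ⟨n, fun m hm => h n m hm A hA⟩)
  have hsum : ∀ f : ℕ → Set E, (∀ i, MeasurableSet (f i)) → Pairwise (Function.onFun Disjoint f) →
      HasSum (fun i => g (f i)) (g (⋃ i, f i)) := by
    intro f hf hd
    have hfin : ∀ n (s : Finset ℕ), ∑ i ∈ s, (μ n).real (f i) = (μ n).real (⋃ i ∈ s, f i) :=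
      fun n s => (measureReal_biUnion_finset (fun i _ j _ hij => hd hij) fun i _ => hf i).symm
    -- Uniformity over finite subfamilies, obtained by applying the Cauchy bound to finite unions,
    -- lets the limits in n and s be exchanged: this is countable additivity.
    have hunif : TendstoUniformly (fun n (s : Finset ℕ) => ∑ i ∈ s, (μ n).real (f i))
        (fun s => ∑ i ∈ s, g (f i)) atTop := by
      rw [Metric.tendstoUniformly_iff]
      intro δ hδ
      filter_upwards [hε.eventually_lt_const hδ] with n hn s
      rw [Real.dist_eq]
      refine lt_of_le_of_lt ?_ hn
      have h1 : Tendsto (fun m => |∑ i ∈ s, (μ m).real (f i) - ∑ i ∈ s, (μ n).real (f i)|) atTop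
          (𝓝 |∑ i ∈ s, g (f i) - ∑ i ∈ s, (μ n).real (f i)|) :=
        ((tendsto_finsetSum s fun i _ => hg (f i) (hf i)).sub_const _).abs
      refine le_of_tendsto h1 (eventually_atTop.2 ⟨n, fun m hm => ?_⟩)
      rw [hfin, hfin]
      exact h n m hm _ (Finset.measurableSet_biUnion s fun i _ => hf i)
    refine hunif.tendsto_of_eventually_tendsto (L := fun n => (μ n).real (⋃ i, f i))
      (Eventually.of_forall fun n => ?_) (hg _ (MeasurableSet.iUnion hf))
    have h2 : ∑' i, μ n (f i) ≠ ∞ := by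
      rw [← measure_iUnion hd hf]; exact measure_ne_top _ _
    have h3 := ENNReal.hasSum_toReal h2
    rwa [← ENNReal.tsum_toReal_eq (ENNReal.ne_top_of_tsum_ne_top h2), ← measure_iUnion hd hf] at h3
  have hempty : g ∅ = 0 := tendsto_nhds_unique (hg ∅ MeasurableSet.empty) (by simp)
  have huniv : g Set.univ = 1 := tendsto_nhds_unique (hg _ MeasurableSet.univ) (by simp)
  set π : Measure E := Measure.ofMeasurable (fun A _ => ENNReal.ofReal (g A)) (by simp [hempty])
    (fun f hf hd => by
      have h1 := hsum f hf hd
      rw [← h1.tsum_eq, ENNReal.ofReal_tsum_of_nonneg (fun i => hg0 _ (hf i)) h1.summable])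
  have hπ : ∀ A, MeasurableSet A → π A = ENNReal.ofReal (g A) := fun A hA =>
    Measure.ofMeasurable_apply A hA
  refine ⟨π, ⟨by rw [hπ _ MeasurableSet.univ, huniv, ENNReal.ofReal_one]⟩, fun n A hA => ?_⟩
  rw [measureReal_def (μ := π), hπ A hA, ENNReal.toReal_ofReal (hg0 A hA)]
  exact hbound n A hA

lemma exp_neg_lt_one (j : ℕ) : Real.exp (-(1 / ((j : ℝ) + 1))) < 1 :=
  (Real.exp_lt_exp.2 (neg_lt_zero.2 (by positivity))).trans_eq Real.exp_zero

/-- The limits of the backward iterates along contracting environments form a kernel. -/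
theorem DriftMinorization.exists_limit_kernel (h : DriftMinorization P V lam b η) (z₀ : E) :
    ∃ π : Kernel (ℕ → F) E, IsMarkovKernel π ∧ ∀ k l j M p, IsContracting lam b η k l j M p →
      ∀ n A, MeasurableSet A → |(backwardKernel P n (p, z₀)).real A - (π p).real A| ≤
        M * (1 + V z₀) * Real.exp (-(1 / ((j : ℝ) + 1))) ^ n /
          (1 - Real.exp (-(1 / ((j : ℝ) + 1)))) := by
  classical
  have hVz := h.V_pos z₀
  set S : Set (ℕ → F) := {p | ∃ k l j M, IsContracting lam b η k l j M p} with hS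
  have hSm : MeasurableSet S := by
    simp only [hS, Set.ofPred_exists]
    exact MeasurableSet.iUnion fun k => MeasurableSet.iUnion fun l => MeasurableSet.iUnion fun j =>
      MeasurableSet.iUnion fun M => h.measurableSet_isContracting k l j M
  have hlim0 : ∀ (j : ℕ) (C : ℝ), Tendsto (fun n => C * Real.exp (-(1 / ((j : ℝ) + 1))) ^ n /
      (1 - Real.exp (-(1 / ((j : ℝ) + 1))))) atTop (𝓝 0) := fun j C => by
    simpa using ((tendsto_pow_atTop_nhds_zero_of_lt_one (Real.exp_nonneg _)
      (exp_neg_lt_one j)).const_mul C).div_const (1 - Real.exp (-(1 / ((j : ℝ) + 1))))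
  -- Outside the measurable set S the value is a Dirac mass, so that the limit is a Markov kernel on
  -- all environments.
  have hex : ∀ p, ∃ π : Measure E, IsProbabilityMeasure π ∧ (p ∉ S → π = Measure.dirac z₀) ∧
      (p ∈ S → ∀ A, MeasurableSet A →
        Tendsto (fun n => (backwardKernel P n (p, z₀)).real A) atTop (𝓝 (π.real A))) := by
    intro p
    by_cases hp : p ∈ S
    · obtain ⟨k, l, j, M, hp'⟩ := hp
      obtain ⟨π, hπ, hb⟩ := exists_isProbabilityMeasure_of_uniform_cauchy
        (μ := fun n => backwardKernel P n (p, z₀)) (hlim0 j (M * (1 + V z₀)))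
        (fun n m hnm A hA => abs_sub_le_of_geometric (u := fun n =>
          (backwardKernel P n (p, z₀)).real A) (Real.exp_nonneg _) (exp_neg_lt_one j)
          (by positivity) (fun n => h.abs_backwardKernel_succ_sub_le hp' n hA z₀) hnm)
      refine ⟨π, hπ, fun hn => absurd ⟨k, l, j, M, hp'⟩ hn, fun _ A hA => ?_⟩
      rw [tendsto_iff_dist_tendsto_zero]
      exact squeeze_zero (fun _ => dist_nonneg) (fun n => by
        rw [Real.dist_eq]; exact hb n A hA) (hlim0 j (M * (1 + V z₀)))
    · exact ⟨Measure.dirac z₀, inferInstance, fun _ => rfl, fun h => absurd h hp⟩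
  choose π hπ hπ0 hπ1 using hex
  have hmeas : Measurable π := by
    refine Measure.measurable_of_measurable_coe _ fun A hA => ?_
    refine measurable_of_tendsto_metrizable (f := fun n => S.piecewise
      (fun p => backwardKernel P n (p, z₀) A) (fun _ => Measure.dirac z₀ A)) (fun n => ?_) ?_
    · exact Measurable.piecewise hSm
        ((Kernel.measurable_coe _ hA).comp measurable_prodMk_right) measurable_const
    · rw [tendsto_pi_nhds]
      intro p
      by_cases hp : p ∈ S
      · simp only [Set.piecewise_eq_of_mem _ _ _ hp]
        have h1 := ENNReal.tendsto_ofReal (hπ1 p hp A hA)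
        rw [ofReal_measureReal] at h1
        exact h1.congr fun n => ofReal_measureReal
      · simp only [Set.piecewise_eq_of_notMem _ _ _ hp, hπ0 p hp]
        exact tendsto_const_nhds
  refine ⟨⟨π, hmeas⟩, ⟨hπ⟩, fun k l j M p hp n A hA => ?_⟩
  have hlim := ((hπ1 p ⟨k, l, j, M, hp⟩ A hA).sub_const ((backwardKernel P n (p, z₀)).real A)).abs
  rw [abs_sub_comm]
  exact le_of_tendsto hlim (eventually_atTop.2 ⟨n, fun m hnm =>
    abs_sub_le_of_geometric (u := fun n => (backwardKernel P n (p, z₀)).real A)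
      (Real.exp_nonneg _) (exp_neg_lt_one j) (by positivity)
      (fun n => h.abs_backwardKernel_succ_sub_le hp n hA z₀) hnm⟩)

end BackwardKernel

/-! ### Setwise convergence of measures. -/

section SetwiseConvergence

variable {E : Type*} [MeasurableSpace E]

lemma tvDist_le {μ ν : Measure E} {c : ℝ}
    (h : ∀ A, MeasurableSet A → |μ.real A - ν.real A| ≤ c) : tvDist μ ν ≤ c :=
  haveI : Nonempty {A : Set E // MeasurableSet A} := ⟨⟨∅, MeasurableSet.empty⟩⟩
  ciSup_le fun A => h A.1 A.2

lemma tvDist_nonneg (μ ν : Measure E) : 0 ≤ tvDist μ ν :=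
  Real.iSup_nonneg fun _ => abs_nonneg _

/-- Fatou's lemma for setwise convergence of measures. -/
lemma lintegral_ofReal_le_liminf {μ : ℕ → Measure E} {π : Measure E}
    (h : ∀ A, MeasurableSet A → Tendsto (fun n => μ n A) atTop (𝓝 (π A))) {f : E → ℝ}
    (hf : Measurable f) (hf0 : ∀ y, 0 ≤ f y) :
    ∫⁻ y, ENNReal.ofReal (f y) ∂π ≤ liminf (fun n => ∫⁻ y, ENNReal.ofReal (f y) ∂(μ n)) atTop := by
  have hlayer : ∀ ν : Measure E, ∫⁻ y, ENNReal.ofReal (f y) ∂ν =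
      ∫⁻ t in Set.Ioi (0 : ℝ), ν {y | t < f y} := fun ν =>
    lintegral_eq_lintegral_meas_lt ν (ae_of_all _ hf0) hf.aemeasurable
  simp_rw [hlayer]
  calc ∫⁻ t in Set.Ioi (0 : ℝ), π {y | t < f y}
      = ∫⁻ t in Set.Ioi (0 : ℝ), liminf (fun n => μ n {y | t < f y}) atTop :=
        lintegral_congr fun t => ((h _ (measurableSet_lt measurable_const hf)).liminf_eq).symm
    _ ≤ _ := lintegral_liminf_le fun n => Antitone.measurable fun s t hst =>
        measure_mono fun y (hy : t < f y) => lt_of_le_of_lt hst hy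

lemma tendsto_measure_of_abs_sub_le {μ : ℕ → Measure E} {π : Measure E}
    [∀ n, IsProbabilityMeasure (μ n)] [IsProbabilityMeasure π] {ε : ℕ → ℝ}
    (hε : Tendsto ε atTop (𝓝 0))
    (h : ∀ n A, MeasurableSet A → |(μ n).real A - π.real A| ≤ ε n) {A : Set E}
    (hA : MeasurableSet A) : Tendsto (fun n => μ n A) atTop (𝓝 (π A)) := by
  have h1 : Tendsto (fun n => (μ n).real A) atTop (𝓝 (π.real A)) := by
    rw [tendsto_iff_dist_tendsto_zero]
    exact squeeze_zero (fun _ => dist_nonneg) (fun n => by rw [Real.dist_eq]; exact h n A hA) hε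
  have h2 := ENNReal.tendsto_ofReal h1
  rw [ofReal_measureReal] at h2
  exact h2.congr fun n => ofReal_measureReal

end SetwiseConvergence

/-! ### Rate, invariance and moments of the limit. -/

section Limit

variable {E F : Type*} [MeasurableSpace E] [MeasurableSpace F] {P : Kernel (F × E) E}
  [IsMarkovKernel P] {V : E → ℝ} {lam b : F → ℝ≥0} {η : ℕ → F → ℝ}

/-- The geometric ratio `exp (-1 / (j + 1))`. -/
noncomputable def geomRatio (j : ℕ) : ℝ := Real.exp (-(1 / ((j : ℝ) + 1)))

lemma geomRatio_pos (j : ℕ) : 0 < geomRatio j := Real.exp_pos _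

lemma geomRatio_lt_one (j : ℕ) : geomRatio j < 1 := exp_neg_lt_one j

/-- The constant in the geometric rate of convergence. -/
noncomputable def rateConst (v : ℝ) (j M : ℕ) : ℝ :=
  M * (1 + v) * (1 + 1 / (1 - geomRatio j)) + 1

/-- The summand 1 in `rateConst` covers M = 0. -/
lemma rateConst_pos {v : ℝ} (hv : 0 < v) (j M : ℕ) : 0 < rateConst v j M := by
  have := sub_pos.2 (geomRatio_lt_one j)
  unfold rateConst
  positivity

/-- Contraction compares the start z with the reference start z₀, so the limit built from z₀ serves
every z. -/
lemma DriftMinorization.abs_backwardKernel_sub_limit_le (h : DriftMinorization P V lam b η)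
    {k l j M : ℕ} {p : ℕ → F} (hp : IsContracting lam b η k l j M p) {π : Measure E} {z₀ : E}
    (hπ : ∀ n A, MeasurableSet A → |(backwardKernel P n (p, z₀)).real A - π.real A| ≤
        M * (1 + V z₀) * Real.exp (-(1 / ((j : ℝ) + 1))) ^ n /
          (1 - Real.exp (-(1 / ((j : ℝ) + 1)))))
    (z : E) (n : ℕ) {A : Set E} (hA : MeasurableSet A) :
    |(backwardKernel P n (p, z)).real A - π.real A| ≤
      rateConst (V z₀) j M * (1 + V z) * geomRatio j ^ n := by
  have hVz := h.V_pos z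
  have hV0 := h.V_pos z₀
  have hr : 0 < 1 - geomRatio j := sub_pos.2 (geomRatio_lt_one j)
  have hr0 := geomRatio_pos j
  have h1 := h.abs_backwardKernel_sub_le k l p n hA z z₀
  have h2 : contractionCoeff lam b η k l p n * (1 + (V z + V z₀)) ≤
      M * geomRatio j ^ n * ((1 + V z) * (1 + V z₀)) := by
    refine mul_le_mul (hp.coeff_le n) ?_ (by positivity) (by positivity)
    nlinarith [mul_pos hVz hV0]
  have h3 : M * (1 + V z₀) * geomRatio j ^ n / (1 - geomRatio j) ≤
      M * (1 + V z₀) * geomRatio j ^ n / (1 - geomRatio j) * (1 + V z) :=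
    le_mul_of_one_le_right (by positivity) (by linarith)
  have h4 := hπ n A hA
  have h5 := abs_sub_le ((backwardKernel P n (p, z)).real A)
    ((backwardKernel P n (p, z₀)).real A) (π.real A)
  calc |(backwardKernel P n (p, z)).real A - π.real A|
      ≤ M * geomRatio j ^ n * ((1 + V z) * (1 + V z₀)) +
        M * (1 + V z₀) * geomRatio j ^ n / (1 - geomRatio j) * (1 + V z) := by
        refine h5.trans (add_le_add (h1.trans h2) (h4.trans h3))
    _ = M * (1 + V z₀) * (1 + 1 / (1 - geomRatio j)) * (1 + V z) * geomRatio j ^ n := by ring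
    _ ≤ _ := by
        unfold rateConst
        gcongr
        linarith

lemma tendsto_mul_geomRatio_pow (C : ℝ) (j : ℕ) :
    Tendsto (fun n => C * geomRatio j ^ n) atTop (𝓝 0) := by
  simpa using (tendsto_pow_atTop_nhds_zero_of_lt_one (geomRatio_pos j).le
    (geomRatio_lt_one j)).const_mul C

/-- Convergence from an initial distribution, up to the mass of `{V > K}`. -/
lemma abs_bind_backwardKernel_sub_le (hV : Measurable V)
    {p : ℕ → F} {π : Measure E} [IsProbabilityMeasure π] {C r : ℝ} (hC : 0 ≤ C) (hr : 0 ≤ r)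
    {n : ℕ} {A : Set E} (hA : MeasurableSet A)
    (hπ : ∀ z, |(backwardKernel P n (p, z)).real A - π.real A| ≤ C * (1 + V z) * r ^ n)
    (μ : Measure E) [IsProbabilityMeasure μ] {K : ℝ} (hK : 0 ≤ K) :
    |(μ.bind (fun y => backwardKernel P n (p, y))).real A - π.real A| ≤
      C * (1 + K) * r ^ n + μ.real {y | K < V y} := by
  have hφi : Integrable (fun y => (backwardKernel P n (p, y)).real A) μ :=
    Integrable.of_bound (measurable_backwardKernel_real p n hA).aestronglyMeasurable 1
      (ae_of_all _ fun y => by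
        rw [Real.norm_eq_abs, abs_of_nonneg measureReal_nonneg]; exact measureReal_le_one)
  have hS : MeasurableSet {y | K < V y} := measurableSet_lt measurable_const hV
  have hsub : (μ.bind (fun y => backwardKernel P n (p, y))).real A - π.real A =
      ∫ y, ((backwardKernel P n (p, y)).real A - π.real A) ∂μ := by
    rw [measureReal_bind (measurable_backwardKernel p n) (fun y => inferInstance) hA,
      integral_sub hφi (integrable_const _)]
    simp
  have hind : Integrable ({y | K < V y}.indicator (fun _ => (1 : ℝ))) μ :=
    (integrable_const _).indicator hS
  rw [hsub]
  calc |∫ y, ((backwardKernel P n (p, y)).real A - π.real A) ∂μ|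
      ≤ ∫ y, |(backwardKernel P n (p, y)).real A - π.real A| ∂μ := abs_integral_le_integral_abs
    _ ≤ ∫ y, (C * (1 + K) * r ^ n + {y | K < V y}.indicator (fun _ => (1 : ℝ)) y) ∂μ := by
        refine integral_mono (hφi.sub (integrable_const _)).abs
          ((integrable_const _).add hind) fun y => ?_
        by_cases hy : K < V y
        · have h1 : {y | K < V y}.indicator (fun _ => (1 : ℝ)) y = 1 :=
            Set.indicator_of_mem (by exact hy) _
          have h2 : 0 ≤ C * (1 + K) * r ^ n := by positivity
          have h3 : |(backwardKernel P n (p, y)).real A - π.real A| ≤ 1 := by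
            rw [abs_le]
            constructor <;> linarith [measureReal_nonneg (μ := backwardKernel P n (p, y)) (s := A),
              measureReal_nonneg (μ := π) (s := A), measureReal_le_one (μ := π) (s := A),
              measureReal_le_one (μ := backwardKernel P n (p, y)) (s := A)]
          simp only [h1]
          linarith
        · have h1 : {y | K < V y}.indicator (fun _ => (1 : ℝ)) y = 0 :=
            Set.indicator_of_notMem (by exact hy) _
          simp only [h1, add_zero]
          refine (hπ y).trans ?_
          have := not_lt.1 hy
          gcongr
    _ = _ := by
        rw [integral_add (integrable_const _) hind, integral_indicator_const _ hS]
        simp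

/-- The definition peels off the kernel applied first; invariance needs the one applied last. -/
lemma backwardIter_succ_eq_stepMeasure {P : Kernel (F × E) E} {p p' : ℕ → F}
    (hpp' : ∀ n, p (n + 1) = p' n) (n : ℕ) (μ : Measure E) :
    backwardIter P p (n + 1) μ = stepMeasure P (backwardIter P p' n μ) (p 0) := by
  induction n generalizing μ with
  | zero => rfl
  | succ n ih => rw [backwardIter, ih, hpp']; rfl

lemma stepMeasure_apply (μ : Measure E) (x : F) {A : Set E} (hA : MeasurableSet A) :
    stepMeasure P μ x A = ∫⁻ y, ENNReal.ofReal ((P (x, y)).real A) ∂μ := by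
  rw [stepMeasure, Measure.bind_apply hA (P.sectR x).measurable.aemeasurable]
  simp

instance isProbabilityMeasure_stepMeasure (μ : Measure E) [IsProbabilityMeasure μ] (x : F) :
    IsProbabilityMeasure (stepMeasure P μ x) := by
  unfold stepMeasure; infer_instance

/-- Invariance of the limits of backward iterates. -/
lemma stepMeasure_eq_of_tendsto {p p' : ℕ → F} (hpp' : ∀ n, p (n + 1) = p' n) {z : E}
    {π π' : Measure E} [IsProbabilityMeasure π] [IsProbabilityMeasure π']
    (hπ : ∀ A, MeasurableSet A →
      Tendsto (fun n => backwardKernel P n (p, z) A) atTop (𝓝 (π A)))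
    (hπ' : ∀ A, MeasurableSet A →
      Tendsto (fun n => backwardKernel P n (p', z) A) atTop (𝓝 (π' A))) :
    stepMeasure P π' (p 0) = π := by
  -- Both sides are probability measures, so the single inequality supplied by Fatou is enough.
  refine Measure.eq_of_le_of_isProbabilityMeasure (Measure.le_intro fun A hA _ => ?_)
  have hm : Measurable fun y => (P (p 0, y)).real A :=
    ((Kernel.measurable_coe P hA).comp measurable_prodMk_left).ennreal_toReal
  rw [stepMeasure_apply _ _ hA]
  refine (lintegral_ofReal_le_liminf hπ' hm fun y => measureReal_nonneg).trans_eq ?_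
  have h1 : ∀ n, ∫⁻ y, ENNReal.ofReal ((P (p 0, y)).real A) ∂(backwardKernel P n (p', z)) =
      backwardKernel P (n + 1) (p, z) A := fun n => by
    rw [← stepMeasure_apply _ _ hA, ← backwardIter_dirac, ← backwardIter_dirac,
      backwardIter_succ_eq_stepMeasure hpp']
  simp_rw [h1]
  exact ((tendsto_add_atTop_iff_nat 1).2 (hπ A hA)).liminf_eq

lemma DriftMinorization.lintegral_backwardKernel_le (h : DriftMinorization P V lam b η)
    (p : ℕ → F) (n : ℕ) (z : E) :
    ∫⁻ y, ENNReal.ofReal (V y) ∂(backwardKernel P n (p, z)) ≤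
      (∏ i ∈ Finset.range n, (lam (p i) : ℝ≥0∞)) * ENNReal.ofReal (V z) +
        ∑ k ∈ Finset.range n, (b (p k) : ℝ≥0∞) * ∏ i ∈ Finset.range k, (lam (p i) : ℝ≥0∞) := by
  induction n generalizing z with
  | zero => simp [backwardKernel_zero, lintegral_dirac' _ h.measurable_V.ennreal_ofReal]
  | succ n ih =>
    rw [backwardKernel_succ, Measure.lintegral_bind (measurable_backwardKernel p n).aemeasurable
      h.measurable_V.ennreal_ofReal.aemeasurable]
    refine (lintegral_mono ih).trans ?_
    rw [lintegral_add_right _ measurable_const,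
      lintegral_const_mul _ h.measurable_V.ennreal_ofReal, lintegral_const, measure_univ, mul_one]
    refine (add_le_add_left (mul_le_mul_right (h.drift (p n) z) _) _).trans_eq ?_
    rw [Finset.prod_range_succ, Finset.sum_range_succ]
    ring

end Limit

/-! ### Subexponential growth of the coefficients. -/

section Tempered

/-- Identically distributed nonnegative integrable variables grow sublinearly. -/
lemma ae_eventually_le_mul_of_identDistrib {Ω : Type*} [MeasurableSpace Ω] {Pr : Measure Ω}
    [IsProbabilityMeasure Pr] {Y : ℕ → Ω → ℝ} {Z : Ω → ℝ} (hZ : Integrable Z Pr)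
    (hZ0 : ∀ ω, 0 ≤ Z ω) (hY : ∀ n, IdentDistrib (Y n) Z Pr Pr) :
    ∀ᵐ ω ∂Pr, ∀ ε : ℝ, 0 < ε → ∀ᶠ n : ℕ in atTop, Y n ω ≤ ε * n := by
  have key : ∀ m : ℕ, ∀ᵐ ω ∂Pr, ∀ᶠ n : ℕ in atTop, Y n ω ≤ 1 / ((m : ℝ) + 1) * n := by
    intro m
    have hm : (0 : ℝ) < (m : ℝ) + 1 := by positivity
    -- Borel–Cantelli: the terms are the tails of (m + 1) Z at the integers, summable because Z is
    -- integrable.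
    have hsum : ∑' n : ℕ, Pr {ω | Y n ω ∈ Set.Ioi (1 / ((m : ℝ) + 1) * n)} ≠ ∞ := by
      let _ : MeasureSpace Ω := ⟨Pr⟩
      have h1 := tsum_prob_mem_Ioi_lt_top (X := fun ω => ((m : ℝ) + 1) * Z ω)
        (hZ.const_mul _) (fun ω => mul_nonneg hm.le (hZ0 ω))
      refine ne_of_lt (lt_of_le_of_lt (ENNReal.tsum_le_tsum fun n => ?_) h1)
      refine ((hY n).measure_mem_eq measurableSet_Ioi).trans_le (measure_mono fun ω hω => ?_)
      simp only [Set.mem_preimage, Set.mem_ofPred_eq, Set.mem_Ioi] at hω ⊢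
      rw [div_mul_eq_mul_div, one_mul, div_lt_iff₀ hm] at hω
      linarith
    filter_upwards [ae_eventually_notMem hsum] with ω hω
    filter_upwards [hω] with n hn
    simpa using hn
  filter_upwards [ae_all_iff.2 key] with ω hω ε hε
  obtain ⟨m, hm⟩ := exists_nat_one_div_lt hε
  filter_upwards [hω m] with n hn
  exact hn.trans (mul_le_mul_of_nonneg_right hm.le n.cast_nonneg)

lemma exists_prod_le_pow_of_limsup_lt_one {a : ℕ → ℝ≥0}
    (h : limsup (fun n : ℕ => (∏ i ∈ Finset.range n, (a i : ℝ≥0∞)) ^ ((1 : ℝ) / (n : ℝ))) atTop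
      < 1) :
    ∃ ρ : ℝ, 0 < ρ ∧ ρ < 1 ∧ ∀ᶠ n : ℕ in atTop, ∏ i ∈ Finset.range n, (a i : ℝ) ≤ ρ ^ n := by
  obtain ⟨c, hc, hc1⟩ := exists_between h
  have hctop : c ≠ ∞ := (hc1.trans ENNReal.one_lt_top).ne
  have hc0 : c ≠ 0 := (lt_of_le_of_lt zero_le hc).ne'
  refine ⟨c.toReal, ENNReal.toReal_pos hc0 hctop, ?_, ?_⟩
  · rw [← ENNReal.toReal_one]
    exact (ENNReal.toReal_lt_toReal hctop ENNReal.one_ne_top).2 hc1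
  · filter_upwards [eventually_lt_of_limsup_lt hc, eventually_gt_atTop 0] with n hn hn0
    have hn1 : (n : ℝ) ≠ 0 := by exact_mod_cast hn0.ne'
    have h1 : ∏ i ∈ Finset.range n, (a i : ℝ≥0∞) ≤ c ^ n := by
      calc ∏ i ∈ Finset.range n, (a i : ℝ≥0∞)
          = ((∏ i ∈ Finset.range n, (a i : ℝ≥0∞)) ^ ((1 : ℝ) / (n : ℝ))) ^ n := by
            rw [← ENNReal.rpow_natCast, ← ENNReal.rpow_mul, one_div_mul_cancel hn1,
              ENNReal.rpow_one]
        _ ≤ c ^ n := by gcongr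
    have h2 := ENNReal.toReal_mono (ENNReal.pow_ne_top hctop) h1
    rw [ENNReal.toReal_pow] at h2
    simpa using h2

lemma le_exp_of_posLog_le {a t : ℝ} (ha : 0 ≤ a) (h : Real.posLog a ≤ t) : a ≤ Real.exp t := by
  rw [Real.posLog_eq_log_max_one ha, Real.log_le_iff_le_exp (by positivity)] at h
  exact (le_max_right _ _).trans h

/-- Summability of the drift series along a tempered environment. -/
lemma exists_drift_bound {a b : ℕ → ℝ≥0} {ρ : ℝ} (hρ0 : 0 < ρ) (hρ1 : ρ < 1)
    (hρ : ∀ᶠ n : ℕ in atTop, ∏ i ∈ Finset.range n, (a i : ℝ) ≤ ρ ^ n)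
    (hb : ∀ ε : ℝ, 0 < ε → ∀ᶠ n : ℕ in atTop, Real.posLog (b n) ≤ ε * n) (v : ℝ) :
    ∃ S : ℝ≥0∞, S < ∞ ∧ ∀ᶠ n : ℕ in atTop,
      (∏ i ∈ Finset.range n, (a i : ℝ≥0∞)) * ENNReal.ofReal v +
        ∑ k ∈ Finset.range n, (b k : ℝ≥0∞) * ∏ i ∈ Finset.range k, (a i : ℝ≥0∞) ≤ S := by
  -- As ρ = exp(-2ε), growth of b at rate ε still leaves terms of size exp(-εn).
  set ε : ℝ := -Real.log ρ / 2 with hε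
  have hlog : Real.log ρ < 0 := Real.log_neg hρ0 hρ1
  have hε0 : 0 < ε := by rw [hε]; linarith
  have hsum : Summable fun k : ℕ => b k * ∏ i ∈ Finset.range k, a i := by
    rw [← NNReal.summable_coe]
    have hr : Real.exp (-ε) < 1 :=
      (Real.exp_lt_exp.2 (neg_lt_zero.2 hε0)).trans_eq Real.exp_zero
    refine Summable.of_norm_bounded_eventually_nat
      (summable_geometric_of_lt_one (Real.exp_nonneg _) hr) ?_
    filter_upwards [hρ, hb ε hε0] with n h1 h2
    have h3 := le_exp_of_posLog_le (b n).2 h2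
    rw [Real.norm_eq_abs, NNReal.abs_eq]
    push_cast
    refine (mul_le_mul h3 h1 (Finset.prod_nonneg fun i _ => (a i).2) (Real.exp_nonneg _)).trans_eq ?_
    rw [← Real.exp_nat_mul, ← Real.exp_log (pow_pos hρ0 n), Real.log_pow, ← Real.exp_add, hε]
    congr 1
    ring
  refine ⟨ENNReal.ofReal v + ∑' k, ((b k * ∏ i ∈ Finset.range k, a i : ℝ≥0) : ℝ≥0∞), ?_, ?_⟩
  · exact ENNReal.add_lt_top.2 ⟨ENNReal.ofReal_lt_top,
      lt_top_iff_ne_top.2 (ENNReal.tsum_coe_ne_top_iff_summable.2 hsum)⟩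
  · filter_upwards [hρ] with n hn
    refine add_le_add ?_ ?_
    · refine mul_le_of_le_one_left zero_le ?_
      have h1 : ∏ i ∈ Finset.range n, a i ≤ 1 := by
        rw [← NNReal.coe_le_coe]
        push_cast
        exact hn.trans (pow_le_one₀ hρ0.le hρ1.le)
      exact_mod_cast h1
    · refine le_trans (le_of_eq ?_) (ENNReal.sum_le_tsum (Finset.range n))
      push_cast
      rfl

/-- An environment with decaying rate and tempered coefficients is contracting. -/
lemma exists_isContracting {F : Type*} {lam b : F → ℝ≥0} {η : ℕ → F → ℝ} {p : ℕ → F} {k l : ℕ}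
    {d : ℝ} (hd : 0 < d)
    (hrate : ∀ᶠ n : ℕ in atTop, ∑ i ∈ Finset.range n, envRate lam b η k l (p i) ≤ -d * n)
    (hlam : ∀ ε : ℝ, 0 < ε → ∀ᶠ n : ℕ in atTop, Real.posLog (lam (p n)) ≤ ε * n)
    (hb : ∀ ε : ℝ, 0 < ε → ∀ᶠ n : ℕ in atTop, Real.posLog (b (p n)) ≤ ε * n) :
    ∃ j M : ℕ, IsContracting lam b η k l j M p := by
  -- The coefficient decays at rate 2δ: one δ pays for 1 + lam + b, the other for the ratio
  -- exp(-1/(j+1)).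
  set δ : ℝ := d / (2 * ((l : ℝ) + 1)) with hδ
  have hδ0 : 0 < δ := by positivity
  obtain ⟨j, hj⟩ := exists_nat_one_div_lt hδ0
  set u : ℕ → ℝ := fun n => contractionCoeff lam b η k l p n * (1 + lam (p n) + b (p n)) *
    Real.exp (1 / ((j : ℝ) + 1)) ^ n with hu
  have hbdd : ∀ᶠ n in atTop, u n ≤ 3 := by
    filter_upwards [hrate, hlam δ hδ0, hb δ hδ0] with n h1 h2 h3
    have hn : (0 : ℝ) ≤ n := n.cast_nonneg
    have h4 := le_exp_of_posLog_le (lam (p n)).coe_nonneg h2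
    have h5 := le_exp_of_posLog_le (b (p n)).coe_nonneg h3
    have h6 : 1 ≤ Real.exp (δ * n) := Real.one_le_exp (by positivity)
    have h7 : contractionCoeff lam b η k l p n ≤ Real.exp (-(2 * δ * n)) := by
      refine Real.exp_le_exp.2 ?_
      rw [div_le_iff₀ (by positivity)]
      refine h1.trans_eq ?_
      rw [hδ]; field_simp
    have h8 : Real.exp (1 / ((j : ℝ) + 1)) ^ n ≤ Real.exp (δ * n) := by
      rw [← Real.exp_nat_mul]
      refine Real.exp_le_exp.2 ?_
      nlinarith
    calc u n ≤ Real.exp (-(2 * δ * n)) * (3 * Real.exp (δ * n)) * Real.exp (δ * n) := by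
          refine mul_le_mul (mul_le_mul h7 (by linarith) (by positivity) (Real.exp_nonneg _)) h8
            (by positivity) (by positivity)
      _ = 3 * Real.exp (-(2 * δ * n) + δ * n + δ * n) := by rw [Real.exp_add, Real.exp_add]; ring
      _ = 3 := by
          rw [show -(2 * δ * n) + δ * n + δ * n = 0 by ring, Real.exp_zero, mul_one]
  -- The finitely many early n are absorbed into M.
  obtain ⟨C, hC⟩ : BddAbove (Set.range u) :=
    (isBoundedUnder_of_eventually_le hbdd).bddAbove_range
  obtain ⟨M, hM⟩ := exists_nat_ge C
  refine ⟨j, M, fun n => ?_⟩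
  have h1 : u n ≤ M := (hC ⟨n, rfl⟩).trans hM
  have h2 : Real.exp (1 / ((j : ℝ) + 1)) ^ n * Real.exp (-(1 / ((j : ℝ) + 1))) ^ n = 1 := by
    rw [← mul_pow, ← Real.exp_add, add_neg_cancel, Real.exp_zero, one_pow]
  have h3 : 0 ≤ Real.exp (-(1 / ((j : ℝ) + 1))) ^ n := by positivity
  calc contractionCoeff lam b η k l p n * (1 + (lam (p n) : ℝ) + (b (p n) : ℝ))
      = u n * Real.exp (-(1 / ((j : ℝ) + 1))) ^ n := by
        simp only [hu]
        linear_combination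
          -(contractionCoeff lam b η k l p n * (1 + (lam (p n) : ℝ) + (b (p n) : ℝ))) * h2
    _ ≤ _ := by gcongr

end Tempered

/-! ### Contraction along stationary pasts. -/

lemma ae_prod_le_pow {Ω F : Type*} [MeasurableSpace Ω] {Pr : Measure Ω} {X : ℤ → Ω → F}
    {lam : F → ℝ≥0}
    (h : ∀ᵐ ω ∂Pr, limsup (fun n : ℕ =>
      (∏ i ∈ Finset.Icc 1 n, (lam (X (-(i : ℤ)) ω) : ℝ≥0∞)) ^ ((1 : ℝ) / (n : ℝ))) atTop < 1) :
    ∀ᵐ ω ∂Pr, ∃ ρ : ℝ, 0 < ρ ∧ ρ < 1 ∧ ∀ᶠ n : ℕ in atTop,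
      ∏ i ∈ Finset.range n, (lam (pastProcess X (-1) ω i) : ℝ) ≤ ρ ^ n := by
  filter_upwards [h] with ω hω
  refine exists_prod_le_pow_of_limsup_lt_one ?_
  have e : ∀ n : ℕ, ∏ i ∈ Finset.range n, (lam (pastProcess X (-1) ω i) : ℝ≥0∞) =
      ∏ i ∈ Finset.Icc 1 n, (lam (X (-(i : ℤ)) ω) : ℝ≥0∞) := fun n => by
    induction n with
    | zero => simp
    | succ n ih =>
      rw [Finset.prod_range_succ, ih, Finset.prod_Icc_succ_top (by lia)]
      congr 3
      simp only [pastProcess]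
      congr 1
      push_cast; ring
  simp_rw [e]
  exact hω

section StationaryProcess

variable {Ω F : Type*} [MeasurableSpace Ω] [MeasurableSpace F] {Pr : Measure Ω}
  {X : ℤ → Ω → F}

lemma measurable_pastProcess (hX : ∀ t, Measurable (X t)) (t : ℤ) :
    Measurable (pastProcess X t) :=
  measurable_pi_lambda _ fun _ => hX _

lemma IsStationaryProcess.identDistrib_past (h : IsStationaryProcess Pr X) (s t : ℤ) :
    IdentDistrib (pastProcess X s) (pastProcess X t) Pr Pr := by
  have key : ∀ t, IdentDistrib (pastProcess X t) (pastProcess X 0) Pr Pr := fun t => by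
    have hm : Measurable fun (x : ℤ → F) (j : ℕ) => x (-(j : ℤ)) := by fun_prop
    have h1 := (h t).comp hm
    have e1 : pastProcess X t = (fun (x : ℤ → F) (j : ℕ) => x (-(j : ℤ))) ∘
        (fun ω t' => X (t' + t) ω) := by
      funext ω j
      simp only [pastProcess, Function.comp_apply]
      rw [neg_add_eq_sub]
    have e2 : pastProcess X 0 = (fun (x : ℤ → F) (j : ℕ) => x (-(j : ℤ))) ∘
        (fun ω t' => X t' ω) := by
      funext ω j
      simp [pastProcess]
    rwa [e1, e2]
  exact (key s).trans (key t).symm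

lemma IsStationaryProcess.identDistrib_eval (h : IsStationaryProcess Pr X) (t : ℤ) :
    IdentDistrib (X t) (X 0) Pr Pr := by
  have h1 := (h.identDistrib_past t 0).comp (measurable_pi_apply 0)
  simpa [Function.comp_def, pastProcess] using h1

variable [IsProbabilityMeasure Pr] {lam b : F → ℝ≥0} {η : ℕ → F → ℝ}

lemma ae_tempered_pastProcess (h : IsStationaryProcess Pr X) {γ : F → ℝ≥0}
    (hγ : HasLogMoment Pr X γ) : ∀ᵐ ω ∂Pr, ∀ ε : ℝ, 0 < ε → ∀ᶠ n : ℕ in atTop,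
      Real.posLog (γ (pastProcess X (-1) ω n)) ≤ ε * n := by
  have hm : Measurable fun x => Real.posLog (γ x : ℝ) := by
    have := hγ.1
    unfold Real.posLog
    fun_prop
  exact ae_eventually_le_mul_of_identDistrib hγ.2 (fun ω => Real.posLog_nonneg)
    fun n => (h.identDistrib_eval (-1 - (n : ℤ))).comp hm

/-- The law on path space is preserved by the backward shift, whose orbit read at coordinate -1 is
the past X_{-1}, X_{-2}, …; the ergodic result applies there and is pulled back to Ω. -/
theorem ae_exists_isContracting (hX : ∀ t, Measurable (X t)) (h : IsStationaryProcess Pr X)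
    (hlam : HasLogMoment Pr X lam) (hb : HasLogMoment Pr X b)
    (hη : ∀ k, Measurable (η k)) (hη0 : ∀ k x, 0 < η k x) (hη1 : ∀ k x, η k x < 1)
    (hprod : ∀ᵐ ω ∂Pr, ∃ ρ : ℝ, 0 < ρ ∧ ρ < 1 ∧ ∀ᶠ n : ℕ in atTop,
      ∏ i ∈ Finset.range n, (lam (pastProcess X (-1) ω i) : ℝ) ≤ ρ ^ n) :
    ∀ᵐ ω ∂Pr, ∃ k l j M, IsContracting lam b η k l j M (pastProcess X (-1) ω) := by
  set Y : Ω → ℤ → F := fun ω t => X t ω with hY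
  have hYm : Measurable Y := measurable_pi_lambda _ hX
  set T : (ℤ → F) → (ℤ → F) := fun x t => x (t + (-1)) with hT
  have hTm : Measurable T := by fun_prop
  have hTmp : MeasurePreserving T (Pr.map Y) (Pr.map Y) := by
    refine ⟨hTm, ?_⟩
    rw [Measure.map_map hTm hYm]
    exact (h (-1)).map_eq
  have hTi : ∀ (i : ℕ) x, T^[i] x (-1) = x (-1 - (i : ℤ)) := by
    intro i
    induction i with
    | zero => intro x; simp
    | succ i ih =>
      intro x
      rw [Function.iterate_succ_apply, ih, hT]
      simp only
      congr 1
      push_cast; ring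
  have hl := hlam.1
  have hbm := hb.1
  have hint : ∀ {γ : F → ℝ≥0}, HasLogMoment Pr X γ →
      Integrable (fun x : ℤ → F => Real.posLog (γ (x (-1)) : ℝ)) (Pr.map Y) := fun {γ} hγ => by
    have hm : Measurable fun x => Real.posLog (γ x : ℝ) := by
      have := hγ.1
      unfold Real.posLog
      fun_prop
    have hm' : Measurable fun x : ℤ → F => Real.posLog (γ (x (-1)) : ℝ) :=
      hm.comp (measurable_pi_apply (-1))
    rw [integrable_map_measure hm'.aestronglyMeasurable hYm.aemeasurable]
    exact ((h.identDistrib_eval (-1)).comp hm).integrable_iff.2 hγ.2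
  have : IsProbabilityMeasure (Pr.map Y) := Measure.isProbabilityMeasure_map hYm.aemeasurable
  have hprod' : ∀ᵐ x ∂(Pr.map Y), ∃ ρ : ℝ, 0 < ρ ∧ ρ < 1 ∧
      ∀ᶠ n : ℕ in atTop, ∏ i ∈ Finset.range n, ((lam (T^[i] x (-1)) : ℝ≥0) : ℝ) ≤ ρ ^ n := by
    -- Replacing ρ by ratios from a countable family makes the set measurable, so the statement
    -- passes to the image law.
    have hgeom : ∀ᵐ ω ∂Pr, Y ω ∈ {x : ℤ → F | ∃ m : ℕ, ∀ᶠ n : ℕ in atTop,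
        ∏ i ∈ Finset.range n, (lam (x (-1 - (i : ℤ))) : ℝ) ≤ geomRatio m ^ n} := by
      filter_upwards [hprod] with ω ⟨ρ, hρ0, hρ1, hρ⟩
      obtain ⟨m, hm⟩ := exists_nat_one_div_lt (neg_pos.2 (Real.log_neg hρ0 hρ1))
      refine ⟨m, ?_⟩
      filter_upwards [hρ] with n hn
      refine hn.trans (pow_le_pow_left₀ hρ0.le ?_ n)
      rw [geomRatio, ← Real.log_le_iff_le_exp hρ0]
      linarith
    have hmeas : MeasurableSet {x : ℤ → F | ∃ m : ℕ, ∀ᶠ n : ℕ in atTop,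
        ∏ i ∈ Finset.range n, (lam (x (-1 - (i : ℤ))) : ℝ) ≤ geomRatio m ^ n} := by
      simp only [eventually_atTop, Set.ofPred_exists, Set.ofPred_forall]
      exact MeasurableSet.iUnion fun m => MeasurableSet.iUnion fun N => MeasurableSet.iInter
        fun n => MeasurableSet.iInter fun _ => measurableSet_le (by fun_prop) measurable_const
    have hmap : ∀ᵐ x ∂(Pr.map Y), x ∈ {x : ℤ → F | ∃ m : ℕ, ∀ᶠ n : ℕ in atTop,
        ∏ i ∈ Finset.range n, (lam (x (-1 - (i : ℤ))) : ℝ) ≤ geomRatio m ^ n} :=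
      (ae_map_iff hYm.aemeasurable hmeas).2 hgeom
    filter_upwards [hmap] with x ⟨m, hm⟩
    exact ⟨geomRatio m, geomRatio_pos m, geomRatio_lt_one m, by simpa only [hTi] using hm⟩
  have hmain := ae_exists_mem_birkhoffLimsupLE_logRate (μ := Pr.map Y) (T := T)
    (a := fun x => (lam (x (-1)) : ℝ)) (b := fun x => (b (x (-1)) : ℝ))
    (e := fun k x => Real.log (1 - η k (x (-1)))) (by fun_prop) (by fun_prop)
    (fun k => by have := hη k; fun_prop) (fun x => by positivity) (fun x => by positivity)
    (fun k x => Real.log_neg (by linarith [hη1 k (x (-1))]) (by linarith [hη0 k (x (-1))]))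
    (hint hlam) (hint hb) hTmp hprod'
  have hmain' := ae_of_ae_map hYm.aemeasurable hmain
  filter_upwards [hmain', ae_tempered_pastProcess h hlam, ae_tempered_pastProcess h hb]
    with ω ⟨k, l, i, hi⟩ h1 h2
  refine ⟨k, l, ?_⟩
  have hd : (0 : ℝ) < 1 / ((i : ℝ) + 1) := by positivity
  refine exists_isContracting (d := 1 / ((i : ℝ) + 1) / 2) (by positivity) ?_ h1 h2
  filter_upwards [mem_birkhoffLimsupLE_iff.1 hi (-(1 / ((i : ℝ) + 1) / 2)) (by linarith)] with n hn
  refine le_trans (le_of_eq ?_) hn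
  refine Finset.sum_congr rfl fun m _ => ?_
  simp only [hTi]
  rfl

end StationaryProcess

/-! ### Tightness, uniqueness and assembly. -/

lemma driftMinorization_of_conditions {Ω E F : Type*} [MeasurableSpace Ω] [MeasurableSpace E]
    [MeasurableSpace F] {Pr : Measure Ω} {X : ℤ → Ω → F} {P : Kernel (F × E) E}
    {V : E → ℝ} {lam b : F → ℝ≥0} {η : ℝ → F → ℝ}
    (hA2 : DriftCondition Pr X P V lam b) (hA3 : SmallSetCondition P V η) :
    DriftMinorization P V lam b (fun k x => η (((k : ℝ) + 1) ^ 2) x) where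
  measurable_V := hA2.measurable_V
  V_pos := hA2.V_pos
  measurable_lam := hA2.lam_mem.1
  measurable_b := hA2.b_mem.1
  drift := hA2.drift
  measurable_eta k := by
    have hk : (0 : ℝ) < ((k : ℝ) + 1) ^ 2 := by positivity
    exact hA3.measurable_eta.comp (measurable_prodMk_left (x := (⟨_, hk⟩ : Set.Ioi (0 : ℝ))))
  eta_pos k x := hA3.eta_pos _ (by positivity) x
  eta_lt_one k x := hA3.eta_lt_one _ (by positivity) x
  minorization k := by
    obtain ⟨ν, hν, h⟩ := hA3.minorization (((k : ℝ) + 1) ^ 2) (by positivity)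
    exact ⟨ν, hν, fun x y hy => Measure.le_intro fun A hA _ => h x y hy A hA⟩

/-- For identically distributed random probability measures, the mass of `{V > K}` along any
sequence has lower limit `0` as `K → ∞`. -/
lemma ae_iInf_liminf_measure_eq_zero {Ω E : Type*} [MeasurableSpace Ω] [MeasurableSpace E]
    {Pr : Measure Ω} [IsFiniteMeasure Pr] {ν : ℕ → Kernel Ω E} [∀ n, IsMarkovKernel (ν n)]
    (hν : ∀ n, IdentDistrib (fun ω => ν n ω) (fun ω => ν 0 ω) Pr Pr) {V : E → ℝ}
    (hV : Measurable V) :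
    ∀ᵐ ω ∂Pr, ⨅ K : ℕ, liminf (fun n => ν n ω {y | (K : ℝ) < V y}) atTop = 0 := by
  have hS : ∀ K : ℕ, MeasurableSet {y | (K : ℝ) < V y} := fun K =>
    measurableSet_lt measurable_const hV
  have hm : ∀ (K n : ℕ), Measurable fun ω => ν n ω {y | (K : ℝ) < V y} := fun K n =>
    Kernel.measurable_coe _ (hS K)
  have hmi : Measurable fun ω => ⨅ K : ℕ, liminf (fun n => ν n ω {y | (K : ℝ) < V y}) atTop :=
    Measurable.iInf fun K => Measurable.liminf (hm K)
  refine (lintegral_eq_zero_iff hmi).1 ?_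
  -- By Fatou the expected lower limit is at most the expected tail of ν 0 at K, which tends to 0.
  have hlim : Tendsto (fun K : ℕ => ∫⁻ ω, ν 0 ω {y | (K : ℝ) < V y} ∂Pr) atTop (𝓝 0) := by
    have h := tendsto_lintegral_of_dominated_convergence (μ := Pr) (fun _ => 1)
      (F := fun (K : ℕ) ω => ν 0 ω {y | (K : ℝ) < V y}) (f := fun _ => 0) (fun K => hm K 0)
      (fun K => ae_of_all _ fun ω => prob_le_one) (by simp) (ae_of_all _ fun ω => ?_)
    · simpa using h
    · have h1 := tendsto_measure_iInter_atTop (μ := ν 0 ω) (s := fun K : ℕ => {y | (K : ℝ) < V y})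
        (fun K => (hS K).nullMeasurableSet)
        (fun K L hKL y (hy : (L : ℝ) < V y) => lt_of_le_of_lt (Nat.cast_le.2 hKL) hy)
        ⟨0, measure_ne_top _ _⟩
      have h2 : ⋂ K : ℕ, {y | (K : ℝ) < V y} = ∅ := by
        ext y
        simp only [Set.mem_iInter, Set.mem_ofPred_eq, Set.mem_empty_iff_false, iff_false, not_forall,
          not_lt]
        exact exists_nat_ge (V y)
      rwa [h2, measure_empty] at h1
  refine le_antisymm (ge_of_tendsto' hlim fun K => ?_) zero_le
  calc ∫⁻ ω, ⨅ K : ℕ, liminf (fun n => ν n ω {y | (K : ℝ) < V y}) atTop ∂Pr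
      ≤ ∫⁻ ω, liminf (fun n => ν n ω {y | (K : ℝ) < V y}) atTop ∂Pr :=
        lintegral_mono fun ω => iInf_le _ K
    _ ≤ liminf (fun n => ∫⁻ ω, ν n ω {y | (K : ℝ) < V y} ∂Pr) atTop := lintegral_liminf_le (hm K)
    _ = ∫⁻ ω, ν 0 ω {y | (K : ℝ) < V y} ∂Pr := by
        have h1 : ∀ n, ∫⁻ ω, ν n ω {y | (K : ℝ) < V y} ∂Pr =
            ∫⁻ ω, ν 0 ω {y | (K : ℝ) < V y} ∂Pr := fun n =>
          ((hν n).comp (Measure.measurable_coe (hS K))).lintegral_eq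
        simp_rw [h1]
        exact liminf_const _

lemma le_liminf_of_le_add {c : ℝ≥0∞} (hc : c ≠ ∞) {u v : ℕ → ℝ≥0∞} (hu : Tendsto u atTop (𝓝 0))
    (h : ∀ n, c ≤ u n + v n) : c ≤ liminf v atTop := by
  have h1 : Tendsto (fun n => c - u n) atTop (𝓝 c) := by
    simpa using ENNReal.Tendsto.sub tendsto_const_nhds hu (Or.inl hc)
  rw [← h1.liminf_eq]
  exact liminf_le_liminf (Eventually.of_forall fun n => tsub_le_iff_left.2 (h n))

lemma backwardIter_pastProcess_eq {Ω E F : Type*} [MeasurableSpace E] [MeasurableSpace F]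
    {X : ℤ → Ω → F} {P : Kernel (F × E) E} {ω : Ω} {ν : ℤ → Measure E}
    (h : ∀ t, stepMeasure P (ν (t - 1)) (X t ω) = ν t) (t : ℤ) (n : ℕ) :
    backwardIter P (pastProcess X t ω) n (ν (t - n)) = ν t := by
  induction n with
  | zero => simp [backwardIter]
  | succ n ih =>
    rw [backwardIter, pastProcess]
    have h1 := h (t - n)
    rw [show t - (n : ℤ) - 1 = t - ((n + 1 : ℕ) : ℤ) by push_cast; ring] at h1
    rw [h1, ih]

theorem mainTheorem3
    {Ω E F : Type*} [MeasurableSpace Ω]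
    [TopologicalSpace E] [PolishSpace E] [MeasurableSpace E] [BorelSpace E]
    [TopologicalSpace F] [PolishSpace F] [MeasurableSpace F] [BorelSpace F]
    (Pr : Measure Ω) [IsProbabilityMeasure Pr]
    (X : ℤ → Ω → F) (hX : ∀ t, Measurable (X t))
    (P : Kernel (F × E) E) [IsMarkovKernel P]
    (V : E → ℝ) (lam b : F → ℝ≥0) (η : ℝ → F → ℝ)
    (hA1 : IsStationaryProcess Pr X)
    (hA2 : DriftCondition Pr X P V lam b)
    (hA3 : SmallSetCondition P V η) :
    ∃ π : Kernel (ℕ → F) E, IsMarkovKernel π ∧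
      -- almost sure convergence in total variation, to a limit that does not depend on `z`
      (∀ᵐ ω ∂Pr, ∀ z : E,
        Tendsto (fun n : ℕ =>
          tvDist (backwardIter P (pastProcess X (-1) ω) n (Measure.dirac z))
            (π (pastProcess X (-1) ω))) atTop (𝓝 0)) ∧
      -- random geometric rate
      (∃ C κ : Ω → ℝ, Measurable C ∧ Measurable κ ∧
        (∀ ω, 0 < C ω) ∧ (∀ ω, 0 < κ ω ∧ κ ω < 1) ∧
        ∀ᵐ ω ∂Pr, ∀ (z : E) (n : ℕ),
          tvDist (backwardIter P (pastProcess X (-1) ω) n (Measure.dirac z))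
            (π (pastProcess X (-1) ω)) ≤ C ω * (1 + V z) * κ ω ^ n) ∧
      -- random invariance
      (∀ t : ℤ, ∀ᵐ ω ∂Pr,
        stepMeasure P (π (pastProcess X (t - 1) ω)) (X t ω) = π (pastProcess X t ω)) ∧
      -- the family is identically distributed
      (∀ s t : ℤ, IdentDistrib (fun ω => π (pastProcess X s ω))
        (fun ω => π (pastProcess X t ω)) Pr Pr) ∧
      -- uniqueness among identically distributed, randomly invariant families
      (∀ ν : ℤ → Kernel Ω E, (∀ t, IsMarkovKernel (ν t)) →
        (∀ s t : ℤ, IdentDistrib (fun ω => ν s ω) (fun ω => ν t ω) Pr Pr) →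
        (∀ t : ℤ, ∀ᵐ ω ∂Pr, stepMeasure P (ν (t - 1) ω) (X t ω) = ν t ω) →
        ∀ t : ℤ, ∀ᵐ ω ∂Pr, ν t ω = π (pastProcess X t ω)) ∧
      -- integrability of the drift function
      (∀ᵐ ω ∂Pr, ∫⁻ y, ENNReal.ofReal (V y) ∂(π (pastProcess X (-1) ω)) < ∞) := by
  classical
  have hD := driftMinorization_of_conditions hA2 hA3
  obtain ⟨ω₀⟩ : Nonempty Ω := nonempty_of_isProbabilityMeasure Pr
  -- Nonemptiness of E comes from a minorizing probability measure.
  obtain ⟨z₀⟩ : Nonempty E := by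
    obtain ⟨ν, hν, -⟩ := hA3.minorization 1 one_pos
    exact nonempty_of_isProbabilityMeasure (ν (X 0 ω₀))
  set η' : ℕ → F → ℝ := fun k x => η (((k : ℝ) + 1) ^ 2) x with hη'
  obtain ⟨π, hπ, hlim⟩ := hD.exists_limit_kernel z₀
  set S : Set (ℕ → F) := {p | ∃ k l j M, IsContracting lam b η' k l j M p} with hS
  have hSm : MeasurableSet S := by
    simp only [hS, Set.ofPred_exists]
    exact MeasurableSet.iUnion fun k => MeasurableSet.iUnion fun l => MeasurableSet.iUnion fun j =>
      MeasurableSet.iUnion fun M => hD.measurableSet_isContracting k l j M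
  have hprod := ae_prod_le_pow hA2.limsup_lt_one
  have hSae : ∀ t, ∀ᵐ ω ∂Pr, pastProcess X t ω ∈ S := fun t =>
    (hA1.identDistrib_past (-1) t).ae_mem_snd hSm
      (ae_exists_isContracting hX hA1 hA2.lam_mem hA2.b_mem hD.measurable_eta hD.eta_pos
        hD.eta_lt_one hprod)
  have hrate : ∀ {k l j M p}, IsContracting lam b η' k l j M p → ∀ z n A, MeasurableSet A →
      |(backwardKernel P n (p, z)).real A - (π p).real A| ≤
        rateConst (V z₀) j M * (1 + V z) * geomRatio j ^ n := fun hp z n A hA =>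
    hD.abs_backwardKernel_sub_limit_le hp (fun n A hA => hlim _ _ _ _ _ hp n A hA) z n hA
  have hsetwise : ∀ p ∈ S, ∀ z A, MeasurableSet A →
      Tendsto (fun n => backwardKernel P n (p, z) A) atTop (𝓝 (π p A)) := by
    rintro p ⟨k, l, j, M, hp⟩ z A hA
    exact tendsto_measure_of_abs_sub_le (tendsto_mul_geomRatio_pow _ j)
      (fun n A hA => hrate hp z n A hA) hA
  refine ⟨π, hπ, ?_, ?_, ?_, ?_, ?_, ?_⟩
  · filter_upwards [hSae (-1)] with ω ⟨k, l, j, M, hp⟩ z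
    refine squeeze_zero (fun n => tvDist_nonneg _ _) (fun n => ?_)
      (tendsto_mul_geomRatio_pow (rateConst (V z₀) j M * (1 + V z)) j)
    rw [backwardIter_dirac]
    exact tvDist_le fun A hA => hrate hp z n A hA
  · obtain ⟨e, he⟩ := exists_surjective_nat (ℕ × ℕ × ℕ × ℕ)
    -- The first admissible index in an enumeration depends measurably on the past, hence so do C
    -- and κ; the alternative p ∉ S makes the search total.
    have hex : ∀ p : ℕ → F, ∃ N, IsContracting lam b η' (e N).1 (e N).2.1 (e N).2.2.1
        (e N).2.2.2 p ∨ p ∉ S := by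
      intro p
      by_cases hp : p ∈ S
      · obtain ⟨k, l, j, M, hp⟩ := hp
        obtain ⟨N, hN⟩ := he (k, l, j, M)
        exact ⟨N, Or.inl (by rw [hN]; exact hp)⟩
      · exact ⟨0, Or.inr hp⟩
    have hidx : Measurable fun p => Nat.find (hex p) := measurable_find hex fun N =>
      (hD.measurableSet_isContracting _ _ _ _).union hSm.compl
    have hidx' := hidx.comp (measurable_pastProcess hX (-1))
    refine ⟨_, _, (measurable_from_nat (f := fun N =>
      rateConst (V z₀) (e N).2.2.1 (e N).2.2.2)).comp hidx', (measurable_from_nat (f := fun N =>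
      geomRatio (e N).2.2.1)).comp hidx', fun ω => rateConst_pos (hD.V_pos z₀) _ _,
      fun ω => ⟨geomRatio_pos _, geomRatio_lt_one _⟩, ?_⟩
    filter_upwards [hSae (-1)] with ω hω z n
    have hp := (Nat.find_spec (hex (pastProcess X (-1) ω))).resolve_right (not_not.2 hω)
    rw [backwardIter_dirac]
    exact tvDist_le fun A hA => hrate hp z n A hA
  · intro t
    filter_upwards [hSae t, hSae (t - 1)] with ω h1 h2
    have h3 := stepMeasure_eq_of_tendsto (P := P) (p := pastProcess X t ω)
      (p' := pastProcess X (t - 1) ω) (z := z₀)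
      (fun n => by simp only [pastProcess]; congr 1; push_cast; ring)
      (fun A hA => hsetwise _ h1 z₀ A hA) (fun A hA => hsetwise _ h2 z₀ A hA)
    simpa [pastProcess] using h3
  · exact fun s t => (hA1.identDistrib_past s t).comp π.measurable
  · intro ν hν hid hinv t
    have htight := ae_iInf_liminf_measure_eq_zero (Pr := Pr) (ν := fun n : ℕ => ν (t - n))
      (fun n => hid _ _) hA2.measurable_V
    filter_upwards [hSae t, ae_all_iff.2 hinv, htight] with ω ⟨k, l, j, M, hp⟩ h1 h2
    refine Measure.ext fun A hA => ?_
    have hC := rateConst_pos (hD.V_pos z₀) j M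
    -- For fixed K the first term vanishes as n → ∞; the lower limit of the second, minimized over
    -- K, is 0.
    have hbound : ∀ K n : ℕ, |(ν t ω).real A - (π (pastProcess X t ω)).real A| ≤
        rateConst (V z₀) j M * (1 + K) * geomRatio j ^ n +
          (ν (t - n) ω).real {y | (K : ℝ) < V y} := fun K n => by
      have h3 := backwardIter_pastProcess_eq (P := P) (ν := fun t => ν t ω) h1 t n
      rw [backwardIter_eq_bind] at h3
      rw [← h3]
      exact abs_bind_backwardKernel_sub_le hA2.measurable_V hC.le (geomRatio_pos j).le hA
        (fun z => hrate hp z n A hA) _ K.cast_nonneg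
    have hzero : ENNReal.ofReal |(ν t ω).real A - (π (pastProcess X t ω)).real A| ≤ 0 := by
      rw [← h2]
      refine le_iInf fun K => le_liminf_of_le_add ENNReal.ofReal_ne_top
        (u := fun n => ENNReal.ofReal (rateConst (V z₀) j M * (1 + K) * geomRatio j ^ n)) ?_
        fun n => ?_
      · simpa using ENNReal.tendsto_ofReal
          (tendsto_mul_geomRatio_pow (rateConst (V z₀) j M * (1 + K)) j)
      · refine (ENNReal.ofReal_le_ofReal (hbound K n)).trans (ENNReal.ofReal_add_le.trans ?_)
        rw [ofReal_measureReal]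
    have h4 := abs_nonpos_iff.1 (ENNReal.ofReal_eq_zero.1 (le_antisymm hzero zero_le))
    exact (measureReal_eq_measureReal_iff).1 (sub_eq_zero.1 h4)
  · filter_upwards [hSae (-1), hprod, ae_tempered_pastProcess hA1 hA2.b_mem]
      with ω hω ⟨ρ, hρ0, hρ1, hρ⟩ hb
    obtain ⟨B, hB, hBn⟩ := exists_drift_bound hρ0 hρ1 hρ hb (V z₀)
    refine lt_of_le_of_lt (lintegral_ofReal_le_liminf (hsetwise _ hω z₀) hA2.measurable_V
      fun y => (hA2.V_pos y).le) (lt_of_le_of_lt ?_ hB)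
    refine (liminf_le_liminf (v := fun _ => B) ?_).trans_eq (liminf_const _)
    filter_upwards [hBn] with n hn
    exact (hD.lintegral_backwardKernel_le _ n z₀).trans hn
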